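/- Let $V=\mathbb C^4$ with coordinates $x_1,\dots,x_4$, let $i=\sqrt{-1}$, and let $\phi_{01}=-2(x_1x_4+x_2x_3)$, $\phi_{02}=2i(-x_1x_4+x_2x_3)$, $\phi_{03}=2i(x_1x_2+x_3x_4)$, $\phi_{04}=2(-x_1x_2+x_3x_4)$, $\phi_{12}=2(x_1x_3-x_2x_4)$, $\phi_{13}=-x_1^2-x_2^2+x_3^2+x_4^2$, $\phi_{14}=i(x_1^2+x_2^2+x_3^2+x_4^2)$, $\phi_{23}=i(-x_1^2+x_2^2-x_3^2+x_4^2)$, $\phi_{24}=x_1^2-x_2^2-x_3^2+x_4^2$, $\phi_{34}=2(x_1x_3+x_2x_4)$. Let $\mathcal R\subset\mathbb C[x_1,\dots,x_4,t_0^{\pm1},\dots,t_4^{\pm1}]$ be the $\mathbb C$-subalgebra generated by $\phi_{jk}t_jt_k$ $(0\le j<k\le 4)$ and $t_k^{-2}$ $(0\le k\le 4)$. It is graded by the exponents of $t_0,\dots,t_4$ in the lattice $\Lambda=\{a\in\mathbb Z^5: 2\mid\sum_k a_k\}$, so the torus $\mathbb T_\Lambda=\operatorname{Hom}(\Lambda,\mathbb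 C^*)$ acts on $\mathcal R$ and on the affine variety $Z=\operatorname{Spec}\mathcal R$, with $f(t\cdot z)=\chi^u(t)f(z)$ for $f\in\mathcal R_u$, $u\in\Lambda$. Let $\kappa=(2,2,2,2,2)\in\Lambda$ and linearize the action on the trivial line bundle by the character $\chi^\kappa$. A point $z\in Z$ is semistable if $f(z)\neq0$ for some $f\in\mathcal R_{n\kappa}$ with $n>0$. It is stable if its isotropy group in $\mathbb T_\Lambda$ is finite and there is some $f\in\mathcal R_{n\kappa}$, $n>0$, with $f(z)\ne0$, such that all $\mathbb T_\Lambda$-orbits in $Z_f=\{f\neq 0\}$ are closed in $Z_f$. Let $Z^{ss}\subset Z$ be the open set of semistable points. Then: 1. every semistable point of $Z$ is stable; 2. the GIT quotient morphism $\pi: Z^{ss}\to\operatorname{Proj}\bigoplus_{n\ge0}\mathcal R_{n\kappa}$ is a geometric quotient for the action of $\mathbb T_\Lambda$: $\pi$ is $\mathbb T_\Lambda$-invariant, affine and surjective, its fibers over closed points are exactly the $\mathbb T_\Lambda$-orbits, the target carries the quotient topology, and for every open $U$ of the target, pulling back along $\pi$ identifies the regular functions on $U$ with the $\mathbb T_\Lambda$-invariant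 regular functions on $\pi^{-1}(U)$; 3. every semistable point of $Z$ has trivial isotropy group in $\mathbb T_\Lambda$. -/

import Mathlib

noncomputable section

namespace Order32

open CategoryTheory AlgebraicGeometry

/-! ### The graded ring `⨁ₙ Pₙ` of a multiplicative sequence of submodules -/

section Graded

variable {S : Type} [CommRing S] [Algebra ℂ S] (P : ℕ → Submodule ℂ S) [SetLike.GradedMonoid P]

/-- The ring `⨁_{n ≥ 0} Pₙ`, realized as `{∑ fₙ sⁿ : fₙ ∈ Pₙ} ⊆ S[s]`. (The sum of the `Pₙ` inside
`S` need not be direct.) -/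
def secRing : Subalgebra ℂ (Polynomial S) where
  carrier := {p | ∀ n, p.coeff n ∈ P n}
  add_mem' {p q} hp hq n := by
    rw [Polynomial.coeff_add]
    exact Submodule.add_mem _ (hp n) (hq n)
  mul_mem' {p q} hp hq n := by
    rw [Polynomial.coeff_mul]
    refine Submodule.sum_mem _ fun x hx => ?_
    rw [← Finset.HasAntidiagonal.mem_antidiagonal.mp hx]
    exact SetLike.GradedMul.mul_mem (hp _) (hq _)
  algebraMap_mem' c n := by
    rw [Polynomial.algebraMap_apply, Polynomial.coeff_C]
    split_ifs with h
    · rw [h, Algebra.algebraMap_eq_smul_one]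
      exact Submodule.smul_mem _ _ SetLike.GradedOne.one_mem
    · exact Submodule.zero_mem _

/-- The degree `n` part `Pₙ sⁿ` of `⨁_{n ≥ 0} Pₙ`. -/
def grade (n : ℕ) : Submodule ℂ (secRing P) where
  carrier := {p | ∀ m, m ≠ n → (p : Polynomial S).coeff m = 0}
  zero_mem' := by simp
  add_mem' {p q} hp hq m hm := by simp [hp m hm, hq m hm]
  smul_mem' c p hp m hm := by simp [hp m hm]

/-- The degree `n` component of an element of `⨁_{n ≥ 0} Pₙ`. -/
def secComp (n : ℕ) (p : secRing P) : grade P n :=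
  ⟨⟨Polynomial.monomial n ((p : Polynomial S).coeff n), fun m => by
      rw [Polynomial.coeff_monomial]
      split_ifs with h
      · exact h ▸ p.2 n
      · exact Submodule.zero_mem _⟩,
    fun m hm => by simp [Polynomial.coeff_monomial, hm.symm]⟩

instance : SetLike.GradedMonoid (grade P) where
  one_mem m hm := by simp [Polynomial.coeff_one, hm]
  mul_mem i j p q hp hq m hm := by
    simp only [MulMemClass.coe_mul, Polynomial.coeff_mul]
    refine Finset.sum_eq_zero fun x hx => ?_
    by_cases h : x.1 = i
    · have : x.2 ≠ j := fun h' =>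
        hm (by rw [← Finset.HasAntidiagonal.mem_antidiagonal.mp hx, h, h'])
      rw [hq _ this, mul_zero]
    · rw [hp _ h, zero_mul]

theorem coeff_coe_directSum (x : DirectSum ℕ fun n => grade P n) (n : ℕ) :
    ((DirectSum.coeAddMonoidHom (grade P) x : secRing P) : Polynomial S).coeff n =
      ((x n : secRing P) : Polynomial S).coeff n := by
  induction x using DirectSum.induction_on with
  | zero => simp
  | of i x =>
    rw [DirectSum.coeAddMonoidHom_of]
    by_cases h : n = i
    · subst h
      rw [DirectSum.of_eq_same]
    · rw [DirectSum.of_eq_of_ne _ _ _ h]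
      simpa using x.2 n h
  | add x y hx hy => simp [hx, hy]

theorem coe_directSum_injective : Function.Injective (DirectSum.coeAddMonoidHom (grade P)) := by
  intro x y hxy
  refine DFinsupp.ext fun n => Subtype.ext (Subtype.ext (Polynomial.ext fun m => ?_))
  by_cases h : m = n
  · subst h
    rw [← coeff_coe_directSum, ← coeff_coe_directSum, hxy]
  · rw [(x n).2 m h, (y n).2 m h]

/-- The decomposition of an element into its components. -/
def decomp (p : secRing P) : DirectSum ℕ fun n => grade P n :=
  ∑ n ∈ (p : Polynomial S).support, DirectSum.of (fun n => grade P n) n (secComp P n p)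

theorem coe_decomp (p : secRing P) : DirectSum.coeAddMonoidHom (grade P) (decomp P p) = p := by
  rw [decomp, map_sum]
  apply Subtype.ext
  simp only [DirectSum.coeAddMonoidHom_of, AddSubmonoidClass.coe_finsetSum]
  exact (Polynomial.as_sum_support (p : Polynomial S)).symm

instance : GradedAlgebra (grade P) where
  decompose' := decomp P
  left_inv := coe_decomp P
  right_inv _ := coe_directSum_injective P (coe_decomp P _)

/-- The homomorphism `∑ fₙ sⁿ ↦ ∑ fₙ` to `S`; it restricts to `Pₙ sⁿ ≅ Pₙ`. -/
def secEval : secRing P →+* S :=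
  (Polynomial.evalRingHom (1 : S)).comp (secRing P).val.toRingHom

/-- The element `f sⁿ` of `⨁ₙ Pₙ`, for `f ∈ Pₙ`. -/
def secMk (n : ℕ) (f : S) (hf : f ∈ P n) : secRing P :=
  ⟨Polynomial.monomial n f, fun m => by
    rw [Polynomial.coeff_monomial]
    split_ifs with h
    · exact h ▸ hf
    · exact Submodule.zero_mem _⟩

theorem secMk_mem (n : ℕ) (f : S) (hf : f ∈ P n) : secMk P n f hf ∈ grade P n :=
  fun m hm => by simp [secMk, Polynomial.coeff_monomial, hm.symm]

theorem secEval_secMk (n : ℕ) (f : S) (hf : f ∈ P n) : secEval P (secMk P n f hf) = f := by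
  simp [secEval, secMk]

end Graded

/-! ### The morphism to `Proj` -/

section ToProj

variable {A : Type} [CommRing A] [Algebra ℂ A] (𝒜 : ℕ → Submodule ℂ A) [GradedAlgebra 𝒜]
  {X : Scheme.{0}} (f : A →+* Γ(X, ⊤))
  (hf : ⨆ x : Σ' (i : ℕ) (r : A), 0 < i ∧ r ∈ 𝒜 i, X.basicOpen (f x.2.1) = ⊤)

theorem glueOpens_aux {X Y : Scheme.{0}} {ι : Type} (U : ι → X.Opens)
    (g : ∀ i, (U i).toScheme ⟶ Y)
    (hg : ∀ i j, X.homOfLE (inf_le_left : U i ⊓ U j ≤ U i) ≫ g i =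
      X.homOfLE (inf_le_right : U i ⊓ U j ≤ U j) ≫ g j) (i j : ι) :
    Limits.pullback.fst (U i).ι (U j).ι ≫ g i = Limits.pullback.snd (U i).ι (U j).ι ≫ g j := by
  rw [← cancel_epi (isPullback_opens_inf (U i) (U j)).isoPullback.hom]
  simpa only [IsPullback.isoPullback_hom_fst_assoc, IsPullback.isoPullback_hom_snd_assoc]
    using hg i j

/-- Gluing of morphisms which are given on the members of an open cover. -/
def glueOpens {X Y : Scheme.{0}} {ι : Type} (U : ι → X.Opens) (hU : ⨆ i, U i = ⊤)
    (g : ∀ i, (U i).toScheme ⟶ Y)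
    (hg : ∀ i j, X.homOfLE (inf_le_left : U i ⊓ U j ≤ U i) ≫ g i =
      X.homOfLE (inf_le_right : U i ⊓ U j ≤ U j) ≫ g j) : X ⟶ Y :=
  (X.openCoverOfIsOpenCover U hU).glueMorphisms g (glueOpens_aux U g hg)

/-- For `r` homogeneous of positive degree, the morphism `D(f(r)) ⟶ Spec (A_r)₀ = D₊(r) ⊆ Proj A`
which is given by `a / r^k ↦ f(a) / f(r)^k`. -/
def toProjAux (x : Σ' (i : ℕ) (r : A), 0 < i ∧ r ∈ 𝒜 i) :
    (X.basicOpen (f x.2.1)).toScheme ⟶ Proj 𝒜 :=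
  Proj.toBasicOpenOfGlobalSections 𝒜 f rfl x.2.2.1 x.2.2.2 ≫ Scheme.Opens.ι _

theorem toProjAux_mul (x y : Σ' (i : ℕ) (r : A), 0 < i ∧ r ∈ 𝒜 i) :
    X.homOfLE (inf_le_left : X.basicOpen (f x.2.1) ⊓ X.basicOpen (f y.2.1) ≤ _) ≫
        toProjAux 𝒜 f x =
      X.homOfLE (inf_le_right : X.basicOpen (f x.2.1) ⊓ X.basicOpen (f y.2.1) ≤ _) ≫
        toProjAux 𝒜 f y := by
  have e : X.basicOpen (f x.2.1) ⊓ X.basicOpen (f y.2.1) = X.basicOpen (f (x.2.1 * y.2.1)) := by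
    rw [map_mul, Scheme.basicOpen_mul]
  have h1 := Proj.homOfLE_toBasicOpenOfGlobalSections_ι 𝒜 f (H := rfl) (H' := rfl)
    (h0d := x.2.2.1) (hd := x.2.2.2) (h0d' := Nat.add_pos_left x.2.2.1 y.1)
    (hd' := SetLike.mul_mem_graded x.2.2.2 y.2.2.2) rfl rfl y.2.2.2
  have h2 := Proj.homOfLE_toBasicOpenOfGlobalSections_ι 𝒜 f (H := rfl) (H' := rfl)
    (h0d := y.2.2.1) (hd := y.2.2.2) (h0d' := Nat.add_pos_left x.2.2.1 y.1)
    (hd' := SetLike.mul_mem_graded x.2.2.2 y.2.2.2) (mul_comm _ _) (add_comm _ _) x.2.2.2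
  have h3 := congrArg (X.homOfLE e.le ≫ ·) (h1.trans h2.symm)
  simpa only [toProjAux, ← Category.assoc, Scheme.homOfLE_homOfLE] using h3

/-- If the `D(f(r))`, for `r` homogeneous of positive degree, cover `X`, then `f` induces a morphism
`X ⟶ Proj A`, glued from the morphisms `D(f(r)) ⟶ D₊(r)` above. -/
def toProj : X ⟶ Proj 𝒜 :=
  glueOpens (fun x : Σ' (i : ℕ) (r : A), 0 < i ∧ r ∈ 𝒜 i => X.basicOpen (f x.2.1)) hf
    (toProjAux 𝒜 f) (toProjAux_mul 𝒜 f)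

end ToProj

/-! ### Geometric quotients -/

/-- Let the group `G` act on the complex algebraic scheme `X` by automorphisms `a g`. (In the
application `G` is the group of complex points of a torus acting algebraically.) The morphism
`π : X ⟶ Y` is a geometric quotient if it is invariant, affine, surjective with the fibers over
closed points being exactly the orbits of closed points, if `Y` carries the quotient topology, and
if the functions on an open `U ⊆ Y` are the invariant functions on `π⁻¹(U)`. -/
structure IsGeometricQuotient {G : Type*} {X Y : Scheme.{0}} (a : G → (X ⟶ X)) (π : X ⟶ Y) :
    Prop where
  invariant : ∀ g, a g ≫ π = π
  affine : IsAffineHom π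
  surjective : Function.Surjective π
  fibers : ∀ x y : X, IsClosed {x} → IsClosed {y} → (π x = π y ↔ ∃ g, a g x = y)
  topology : Topology.IsQuotientMap π
  injective : ∀ U : Y.Opens, Function.Injective (π.app U)
  functions : ∀ (U : Y.Opens) (s : Γ(X, π ⁻¹ᵁ U)),
    (∃ r : Γ(Y, U), π.app U r = s) ↔
      ∀ g, (a g).appLE (π ⁻¹ᵁ U) (π ⁻¹ᵁ U)
        (by rw [← Scheme.Hom.comp_preimage, invariant g]) s = s

/-! ### The ring `ℛ` and the torus acting on it -/

/-- The coordinate ring `ℂ[V] = ℂ[x₁, …, x₄]`; the coordinate `x_{i+1}` is `X i`. -/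
abbrev CV : Type := MvPolynomial (Fin 4) ℂ

open MvPolynomial in
/-- The quadratic forms `φ_{ij}`, `0 ≤ i < j ≤ 4` (only these indices are used). -/
def phi : Fin 5 → Fin 5 → CV
  | 0, 1 => -2 * (X 0 * X 3 + X 1 * X 2)
  | 0, 2 => 2 * C Complex.I * (-(X 0 * X 3) + X 1 * X 2)
  | 0, 3 => 2 * C Complex.I * (X 0 * X 1 + X 2 * X 3)
  | 0, 4 => 2 * (-(X 0 * X 1) + X 2 * X 3)
  | 1, 2 => 2 * (X 0 * X 2 - X 1 * X 3)
  | 1, 3 => -X 0 ^ 2 - X 1 ^ 2 + X 2 ^ 2 + X 3 ^ 2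
  | 1, 4 => C Complex.I * (X 0 ^ 2 + X 1 ^ 2 + X 2 ^ 2 + X 3 ^ 2)
  | 2, 3 => C Complex.I * (-X 0 ^ 2 + X 1 ^ 2 - X 2 ^ 2 + X 3 ^ 2)
  | 2, 4 => X 0 ^ 2 - X 1 ^ 2 - X 2 ^ 2 + X 3 ^ 2
  | 3, 4 => 2 * (X 0 * X 2 + X 1 * X 3)
  | _, _ => 0

/-- The lattice `Λ = {∑ aᵢ eᵢ : aᵢ ∈ ℤ, 2 ∣ ∑ aᵢ}` of characters of `𝕋_Λ`. -/
def Lam : AddSubgroup (Fin 5 → ℤ) where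
  carrier := {a | Even (∑ i, a i)}
  zero_mem' := by simp
  add_mem' {a b} ha hb := by
    simp only [Set.mem_ofPred_eq, Pi.add_apply, Finset.sum_add_distrib] at *
    exact ha.add hb
  neg_mem' {a} ha := by
    simp only [Set.mem_ofPred_eq, Pi.neg_apply, Finset.sum_neg_distrib] at *
    exact ha.neg

theorem mem_Lam {a : Fin 5 → ℤ} : a ∈ Lam ↔ Even (∑ i, a i) := Iff.rfl

/-- The degree `e_i + e_j` of `t_i t_j`. -/
def degW (i j : Fin 5) : Lam :=
  ⟨Pi.single i 1 + Pi.single j 1, by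
    simp [mem_Lam, Finset.sum_add_distrib, Finset.sum_pi_single']⟩

/-- The degree `-2 e_k` of `t_k⁻²`. -/
def degU (k : Fin 5) : Lam := ⟨Pi.single k (-2), by simp [mem_Lam, Finset.sum_pi_single']⟩

/-- The character `κ = (2, 2, 2, 2, 2)`. -/
def kappa : Lam := ⟨fun _ => 2, by simp [mem_Lam]; decide⟩

/-- `ℂ[V] ⊗ ℂ[Λ]`: Laurent polynomials in `t₀, …, t₄` over `ℂ[V]`, all of whose exponents lie
in `Λ`. -/
abbrev Amb : Type := AddMonoidAlgebra CV Lam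

/-- `ℛ ⊆ ℂ[V][t₀^{±1}, …, t₄^{±1}]` is the `ℂ`-subalgebra generated by the `φ_{ij} t_i t_j`, `i < j`,
and the `t_k⁻²`. The exponents of all these generators lie in `Λ`, so `ℛ ⊆ ℂ[V] ⊗ ℂ[Λ]`. -/
def ringR : Subalgebra ℂ Amb :=
  Algebra.adjoin ℂ
    ({f | ∃ i j : Fin 5, i < j ∧ f = AddMonoidAlgebra.single (degW i j) (phi i j)} ∪
      {f | ∃ k : Fin 5, f = AddMonoidAlgebra.single (degU k) 1})

/-- The ring `ℛ`, as a type. -/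
def RR : Type := ringR

instance : CommRing RR := inferInstanceAs (CommRing ringR)

instance : Algebra ℂ RR := inferInstanceAs (Algebra ℂ ringR)

/-- The inclusion `ℛ ⊆ ℂ[V] ⊗ ℂ[Λ]`. -/
def incl : RR →ₐ[ℂ] Amb := ringR.val

theorem incl_injective : Function.Injective incl := Subtype.val_injective

/-- The (complex points of the) torus `𝕋_Λ = Hom(Λ, ℂ^*)`. -/
abbrev TLam : Type := Multiplicative Lam →* ℂˣ

/-- The value `χ^u(t)` of the character `χ^u` at `t`. -/
def chi (u : Lam) (t : TLam) : ℂ := (t (Multiplicative.ofAdd u) : ℂˣ)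

/-- The action of `t` on `ℂ[V] ⊗ ℂ[Λ]`: multiplication by `χ^u(t)` in degree `u`. -/
def ambAct (t : TLam) : Amb →ₐ[ℂ] Amb :=
  (AddMonoidAlgebra.lift CV Amb Lam
    { toFun := fun u =>
        AddMonoidAlgebra.single u.toAdd (MvPolynomial.C (chi u.toAdd t) : CV)
      map_one' := by simp [chi, AddMonoidAlgebra.one_def]
      map_mul' := fun u v => by
        simp [chi, AddMonoidAlgebra.single_mul_single] }).restrictScalars ℂ

theorem ambAct_single (t : TLam) (u : Lam) (p : CV) :
    ambAct t (AddMonoidAlgebra.single u p) = chi u t • AddMonoidAlgebra.single u p := by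
  simp [ambAct, AddMonoidAlgebra.lift_single, MvPolynomial.smul_eq_C_mul, mul_comm]

theorem ambAct_mem (t : TLam) (f : RR) : ambAct t (incl f) ∈ ringR := by
  have h : ringR ≤ ringR.comap (ambAct t) := by
    refine Algebra.adjoin_le ?_
    rintro f (⟨i, j, hij, rfl⟩ | ⟨k, rfl⟩)
    · simp only [Subalgebra.coe_comap, Set.mem_preimage, ambAct_single]
      exact ringR.smul_mem (Algebra.subset_adjoin (Or.inl ⟨i, j, hij, rfl⟩)) _
    · simp only [Subalgebra.coe_comap, Set.mem_preimage, ambAct_single]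
      exact ringR.smul_mem (Algebra.subset_adjoin (Or.inr ⟨k, rfl⟩)) _
  exact h f.2

/-- The action of `𝕋_Λ` on `ℛ`. -/
def act (t : TLam) : RR →ₐ[ℂ] RR :=
  ((ambAct t).comp incl).codRestrict ringR (ambAct_mem t)

theorem incl_act (t : TLam) (f : RR) : incl (act t f) = ambAct t (incl f) := rfl

theorem act_one (f : RR) : act 1 f = f := by
  apply incl_injective
  rw [incl_act]
  induction incl f using AddMonoidAlgebra.induction_linear with
  | zero => simp
  | add f g hf hg => rw [map_add, hf, hg]
  | single u p => simp [ambAct_single, chi]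

theorem act_mul (s t : TLam) (f : RR) : act (s * t) f = act t (act s f) := by
  apply incl_injective
  simp only [incl_act]
  induction incl f using AddMonoidAlgebra.induction_linear with
  | zero => simp
  | add f g hf hg => simp only [map_add, hf, hg]
  | single u p => simp only [ambAct_single, map_smul, smul_smul]; simp [chi]

/-- The graded piece `ℛ_u`, `u ∈ Λ`. -/
def piece (u : Lam) : Submodule ℂ RR where
  carrier := {f | ∃ p : CV, incl f = AddMonoidAlgebra.single u p}
  zero_mem' := ⟨0, by simp⟩
  add_mem' := by
    rintro f g ⟨p, hp⟩ ⟨q, hq⟩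
    exact ⟨p + q, by simp [hp, hq, AddMonoidAlgebra.single_add]⟩
  smul_mem' := by
    rintro c f ⟨p, hp⟩
    exact ⟨c • p, by simp [hp]⟩

theorem act_of_mem_piece {u : Lam} {f : RR} (hf : f ∈ piece u) (t : TLam) :
    act t f = chi u t • f := by
  obtain ⟨p, hp⟩ := hf
  apply incl_injective
  rw [incl_act, hp, ambAct_single, map_smul, hp]

theorem one_mem_piece : (1 : RR) ∈ piece 0 := ⟨1, by simp [AddMonoidAlgebra.one_def]⟩

theorem mul_mem_piece {u v : Lam} {f g : RR} (hf : f ∈ piece u) (hg : g ∈ piece v) :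
    f * g ∈ piece (u + v) := by
  obtain ⟨p, hp⟩ := hf
  obtain ⟨q, hq⟩ := hg
  exact ⟨p * q, by simp [hp, hq, AddMonoidAlgebra.single_mul_single]⟩

/-! ### Points, stability -/

/-- The points of `Spec ℛ` (maximal spectrum of a finitely generated `ℂ`-algebra), given by their
evaluation homomorphisms `f ↦ f(z)`. -/
def Pt : Type := RR →ₐ[ℂ] ℂ

/-- A point as an algebra homomorphism. -/
def Pt.toAlgHom (z : Pt) : RR →ₐ[ℂ] ℂ := z

/-- The value `f(z)`. -/
def Pt.eval (z : Pt) (f : RR) : ℂ := z.toAlgHom f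

/-- The maximal ideal of a point. -/
def Pt.toSpec (z : Pt) : PrimeSpectrum RR :=
  ⟨RingHom.ker z.toAlgHom, RingHom.ker_isPrime z.toAlgHom⟩

/-- The Zariski topology on the points of `Spec ℛ`. -/
instance : TopologicalSpace Pt := TopologicalSpace.induced Pt.toSpec inferInstance

/-- The action of `𝕋_Λ` on the points of `Spec ℛ`: `f(t • z) = (t · f)(z)`, so that
`f(t • z) = χ^u(t) f(z)` for `f ∈ ℛ_u`. -/
instance : MulAction TLam Pt where
  smul t z := z.toAlgHom.comp (act t)
  one_smul z := AlgHom.ext fun f => congrArg (Pt.eval z) (act_one f)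
  mul_smul s t z := AlgHom.ext fun f => congrArg (Pt.eval z) (act_mul s t f)

theorem Pt.eval_smul (t : TLam) (z : Pt) (f : RR) : (t • z).eval f = z.eval (act t f) := rfl

/-- `z` is semistable for the linearization of the trivial bundle by `χ^u`: some invariant section
of a positive tensor power, that is some `f ∈ ℛ_{nu}` with `n > 0`, does not vanish at `z`. -/
def IsSemistable (u : Lam) (z : Pt) : Prop :=
  ∃ n : ℕ, 0 < n ∧ ∃ f ∈ piece (n • u), z.eval f ≠ 0

/-- `z` is stable for the linearization by `χ^u`: its isotropy group is finite and there is some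
`f ∈ ℛ_{nu}`, `n > 0`, with `f(z) ≠ 0` such that all orbits in `(Spec ℛ)_f` are closed in
`(Spec ℛ)_f`. -/
def IsStable (u : Lam) (z : Pt) : Prop :=
  Finite (MulAction.stabilizer TLam z) ∧
    ∃ n : ℕ, 0 < n ∧ ∃ f ∈ piece (n • u), z.eval f ≠ 0 ∧
      ∀ y : Pt, y.eval f ≠ 0 →
        IsClosed ((↑) ⁻¹' MulAction.orbit TLam y : Set {w : Pt // w.eval f ≠ 0})

/-! ### The GIT quotient `Proj (⨁ₙ ℛ_{nu})` -/

/-- The index set of the pairs `(n, f)` with `n > 0` and `f ∈ ℛ_{nu}`. -/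
abbrev PosSection (u : Lam) : Type := {x : ℕ × RR // 0 < x.1 ∧ x.2 ∈ piece (x.1 • u)}

/-- The scheme `Spec ℛ`. -/
abbrev SpecRR : Scheme.{0} := Spec (CommRingCat.of RR)

/-- The open subscheme `(Spec ℛ)^{ss}` of semistable points. -/
def ssLocus (u : Lam) : SpecRR.Opens :=
  ⨆ x : PosSection u, PrimeSpectrum.basicOpen x.1.2

/-- The automorphism of `Spec ℛ` given by `t ∈ 𝕋_Λ`. -/
def actSpec (t : TLam) : SpecRR ⟶ SpecRR := Spec.map (CommRingCat.ofHom (act t).toRingHom)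

theorem chi_ne_zero (u : Lam) (t : TLam) : chi u t ≠ 0 := Units.ne_zero _

theorem ssLocus_le (u : Lam) (t : TLam) : ssLocus u ≤ actSpec t ⁻¹ᵁ ssLocus u := by
  intro x hx
  obtain ⟨⟨⟨n, f⟩, hn, hf⟩, hx⟩ := TopologicalSpace.Opens.mem_iSup.mp hx
  refine TopologicalSpace.Opens.mem_iSup.mpr ⟨⟨⟨n, f⟩, hn, hf⟩, ?_⟩
  change act t f ∉ x.asIdeal
  rw [act_of_mem_piece hf t]
  intro h
  refine hx ?_
  have := x.asIdeal.mul_mem_left (algebraMap ℂ RR (chi (n • u) t)⁻¹) h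
  rwa [← Algebra.smul_def, smul_smul, inv_mul_cancel₀ (chi_ne_zero _ _), one_smul] at this

/-- The action of `t ∈ 𝕋_Λ` on `(Spec ℛ)^{ss}`. -/
def actSS (u : Lam) (t : TLam) : (ssLocus u).toScheme ⟶ (ssLocus u).toScheme :=
  (actSpec t).resLE _ _ (ssLocus_le u t)

/-- The graded pieces `ℛ_{nu}`, `n ≥ 0`. -/
def sections (u : Lam) (n : ℕ) : Submodule ℂ RR := piece (n • u)

instance (u : Lam) : SetLike.GradedMonoid (sections u) where
  one_mem := by
    simp only [sections, zero_smul]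
    exact one_mem_piece
  mul_mem i j f g hf hg := by
    simp only [sections, add_smul]
    exact mul_mem_piece hf hg

/-- The GIT quotient of `Spec ℛ` by `𝕋_Λ` for the linearization `χ^u`, as a scheme. -/
def gitQuotient (u : Lam) : Scheme.{0} := Proj (grade (sections u))

/-- The homomorphism from `⨁_{n ≥ 0} ℛ_{nu}` to the functions on `(Spec ℛ)^{ss}`, given by
restricting functions on `Spec ℛ`. -/
def toFunctions (u : Lam) : secRing (sections u) →+* Γ((ssLocus u).toScheme, ⊤) :=
  ((Scheme.ΓSpecIso (CommRingCat.of RR)).inv ≫ (ssLocus u).ι.appTop).hom.comp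
    (secEval (sections u))

theorem basicOpen_toFunctions (u : Lam) (r : secRing (sections u)) :
    (ssLocus u).toScheme.basicOpen (toFunctions u r) =
      (ssLocus u).ι ⁻¹ᵁ PrimeSpectrum.basicOpen (secEval (sections u) r) := by
  have h := Scheme.preimage_basicOpen_top (ssLocus u).ι
    ((Scheme.ΓSpecIso (CommRingCat.of RR)).inv (secEval (sections u) r))
  rw [basicOpen_eq_of_affine] at h
  exact h.symm

theorem iSup_basicOpen_toFunctions (u : Lam) :
    ⨆ x : Σ' (i : ℕ) (r : secRing (sections u)), 0 < i ∧ r ∈ grade (sections u) i,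
      (ssLocus u).toScheme.basicOpen (toFunctions u x.2.1) = ⊤ := by
  rw [eq_top_iff]
  rintro ⟨x, hx⟩ -
  obtain ⟨⟨⟨n, f⟩, hn, hf⟩, hx'⟩ := TopologicalSpace.Opens.mem_iSup.mp hx
  have hf' : f ∈ sections u n := hf
  refine TopologicalSpace.Opens.mem_iSup.mpr
    ⟨⟨n, secMk (sections u) n f hf', hn, secMk_mem (sections u) n f hf'⟩, ?_⟩
  have h : (ssLocus u).toScheme.basicOpen (toFunctions u (secMk (sections u) n f hf')) =
      (ssLocus u).ι ⁻¹ᵁ PrimeSpectrum.basicOpen f := by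
    rw [basicOpen_toFunctions, secEval_secMk]
  exact h.ge hx'

/-- The quotient morphism from `(Spec ℛ)^{ss}` to the GIT quotient. -/
def quotientMap (u : Lam) : (ssLocus u).toScheme ⟶ gitQuotient u :=
  toProj (grade (sections u)) (toFunctions u) (iSup_basicOpen_toFunctions u)

end Order32

end

/-!
Write `w_{ij} = ± φ_{ij} t_i t_j` and `u_k = t_k⁻²` for the generators of `ℛ`. Everything rests on the
Plücker relations `w_{ij} w_{kl} - w_{ik} w_{jl} + w_{il} w_{jk} = 0` (`ww_plucker`), valid after the
signs of some `φ_{ij}` have been changed, and on the notion of a good section: a homogeneous element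
`g` of degree `n κ` such that `ℛ_g` has homogeneous units of all degrees `u ∈ Λ` (`IsGood`).

*Good sections exist at every semistable point* (`exists_isGood`). Let `P` be a prime ideal of `ℛ`
which does not contain some homogeneous element of degree `n κ`, `n > 0`. This forces linear
inequalities between the degrees of the generators outside of `P`: each index `i` occurs in some
`w_{ij} ∉ P`, and if all `w_{ij}` with `i, j` outside of a set `E` of at most two indices lie in `P`,
then `u_k ∉ P` for some `k ∈ E`. By the Plücker relations, `w_{ij} ∈ P` is an equivalence relation on
the indices. If all its classes have at most two elements, the indices can be ordered in a `5`-cycle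
with `w_{ab} w_{bc} w_{cd} w_{de} w_{ea} ∉ P`; in the presence of a class of three or four elements
there is a similar monomial in which the generators `u_k`, `k` outside of the class, compensate the
degrees. These monomials have degree `κ`, and the degrees of their factors generate `Λ`.

*Consequences on `D(g)`, for `g` good.* If a torus element fixes a point of `D(g)`, every character takes
the value `1` on it, since there is a homogeneous function of the corresponding degree which does not
vanish at the point (`stabilizer_eq_bot_of_isGood`). Two points of `D(g)` lie in one
orbit as soon as the functions of degree `0` on `D(g)` agree on them (`exists_smul_eq`), as the ratios of
the values of homogeneous units then define an element of the torus; so orbits are closed in `D(g)`.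
As `Λ` is a free group, the homogeneous units can be chosen multiplicatively in the degree, and dividing by
them retracts `ℛ_g` onto its part of degree `0`, which is the ring of functions on `D₊(g)`
(`exists_retraction`): `D(g) → D₊(g)` is a torus bundle with a section.

*Gluing.* A morphism which over a basis of open sets is given by inclusions of rings of invariants
with retractions, and which separates orbits of closed points, is a geometric quotient
(`IsGeometricQuotient.of_charts`). The sets `D₊(g)`, `g` good, form a basis of the topology of `Proj`
(`exists_quotientOpen_le`), as a good section stays good when multiplied by a section, and
closed points in one fiber lie in one orbit by the above (`exists_actSS_eq`).
-/

noncomputable section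

namespace Order32

open CategoryTheory AlgebraicGeometry

/-! ### The morphism to `Proj` on points and on basic open subsets -/

section ToProjLemmas

theorem exists_specField_apply_eq {X : Scheme.{0}} (x : X) :
    ∃ (S : Type) (_ : Field S) (q : Spec (CommRingCat.of S) ⟶ X) (y : Spec (CommRingCat.of S)),
      q y = x := by
  have hx : x ∈ Set.range (X.fromSpecResidueField x) := by
    rw [Scheme.range_fromSpecResidueField]
    exact rfl
  obtain ⟨y, hy⟩ := hx
  exact ⟨X.residueField x, inferInstance, X.fromSpecResidueField x, y, hy⟩

/-- A morphism to `X` followed by `X ⟶ Spec Γ(X, 𝒪)` is given by the pullback of global functions. -/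
theorem comp_toSpecΓ {X : Scheme.{0}} {S : Type} [CommRing S]
    (q : Spec (CommRingCat.of S) ⟶ X) :
    q ≫ X.toSpecΓ = Spec.map (q.appTop ≫ (Scheme.ΓSpecIso (CommRingCat.of S)).hom) := by
  rw [Scheme.toSpecΓ_naturality, Spec.map_comp]
  congr 1
  simp

/-- The morphism `D(x) ⟶ Spec Γ(X, 𝒪)_x` on `S`-points: it is given by any extension `ψ` of the pullback
of global functions to the localization. -/
theorem comp_toSpecAway {X : Scheme.{0}} (x : Γ(X, ⊤)) {S : Type} [CommRing S]
    (q : Spec (CommRingCat.of S) ⟶ (X.basicOpen x).toScheme) (ψ : Localization.Away x →+* S)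
    (hψ : ∀ a, (Scheme.ΓSpecIso (CommRingCat.of S)).hom
      ((q ≫ (X.basicOpen x).ι).appTop a) = ψ (algebraMap _ _ a)) :
    q ≫ (X.isoOfEq (X.toSpecΓ_preimage_basicOpen x)).inv ≫ X.toSpecΓ ∣_ _ ≫
      (basicOpenIsoSpecAway x).hom = Spec.map (CommRingCat.ofHom ψ) := by
  rw [← cancel_mono (Spec.map (CommRingCat.ofHom (algebraMap Γ(X, ⊤) (Localization.Away x))))]
  simp only [Category.assoc]
  rw [basicOpenIsoSpecAway_hom_SpecMap, ← Spec.map_comp]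
  have : X.toSpecΓ ∣_ _ ≫ Scheme.Opens.ι (X := Spec Γ(X, ⊤)) (PrimeSpectrum.basicOpen x) =
    Scheme.Opens.ι _ ≫ X.toSpecΓ := morphismRestrict_ι _ _
  rw [this, Scheme.isoOfEq_inv_ι_assoc, ← Category.assoc, comp_toSpecΓ]
  congr 1
  ext a
  exact hψ a

variable {A : Type} [CommRing A] [Algebra ℂ A] (𝒜 : ℕ → Submodule ℂ A) [GradedAlgebra 𝒜]
  {X : Scheme.{0}} (f : A →+* Γ(X, ⊤))
  (hf : ⨆ x : Σ' (i : ℕ) (r : A), 0 < i ∧ r ∈ 𝒜 i, X.basicOpen (f x.2.1) = ⊤)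

/-- The homomorphism `(A_r)₀ → S` given by `a / r^k ↦ φ(a) / φ(r)^k`, for a homomorphism
`φ : A → S` such that `φ(r)` is a unit. -/
def awayLift {S : Type} [CommRing S] (φ : A →+* S) (r : A) (hu : IsUnit (φ r)) :
    HomogeneousLocalization.Away 𝒜 r →+* S :=
  (IsLocalization.Away.lift (S := Localization.Away r) r hu).comp
    (algebraMap (HomogeneousLocalization.Away 𝒜 r) _)

theorem awayLift_mk_mul {S : Type} [CommRing S] (φ : A →+* S) {r : A} (hu : IsUnit (φ r))
    {n : ℕ} (hr : r ∈ 𝒜 n) (k : ℕ) (a : A) (ha : a ∈ 𝒜 (k • n)) :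
    awayLift 𝒜 φ r hu (HomogeneousLocalization.Away.mk 𝒜 hr k a ha) * φ r ^ k = φ a := by
  simp only [awayLift, RingHom.comp_apply, HomogeneousLocalization.algebraMap_apply,
    HomogeneousLocalization.Away.val_mk]
  rw [← IsLocalization.Away.lift_eq (S := Localization.Away r) r hu r, ← map_pow, ← map_mul,
    ← map_pow, Localization.mk_eq_mk', IsLocalization.mk'_spec_mk, IsLocalization.Away.lift_eq]

theorem ι_toProj {n : ℕ} (hn : 0 < n) {r : A} (hr : r ∈ 𝒜 n) :
    (X.basicOpen (f r)).ι ≫ toProj 𝒜 f hf =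
      Proj.toBasicOpenOfGlobalSections 𝒜 f rfl hn hr ≫ Scheme.Opens.ι _ :=
  (X.openCoverOfIsOpenCover _ hf).ι_glueMorphisms (toProjAux 𝒜 f)
    (glueOpens_aux _ _ (toProjAux_mul 𝒜 f)) ⟨n, r, hn, hr⟩

/-- The morphism `X ⟶ Proj A` on those `S`-points `q` of `X` at which `f(r)` is invertible: if `φ` is the
pullback of functions to `q`, it is the point of `D₊(r)` given by `a / r^k ↦ φ(a) / φ(r)^k`. -/
theorem comp_toProj {S : Type} [CommRing S] (q : Spec (CommRingCat.of S) ⟶ X) (φ : A →+* S)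
    (hφ : ∀ a, (Scheme.ΓSpecIso (CommRingCat.of S)).hom (q.appTop (f a)) = φ a)
    {n : ℕ} (hn : 0 < n) {r : A} (hr : r ∈ 𝒜 n) (hu : IsUnit (φ r)) :
    q ≫ toProj 𝒜 f hf = Spec.map (CommRingCat.ofHom (awayLift 𝒜 φ r hu)) ≫ Proj.awayι 𝒜 r hr hn := by
  have hu' : IsUnit (((Scheme.ΓSpecIso (CommRingCat.of S)).hom.hom.comp q.appTop.hom) (f r)) :=
    (hφ r).symm ▸ hu
  have hq : q ⁻¹ᵁ (X.basicOpen (f r)) = ⊤ := by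
    rw [Scheme.preimage_basicOpen_top]
    refine Scheme.basicOpen_of_isUnit _ ?_
    exact (isUnit_map_iff (Scheme.ΓSpecIso (CommRingCat.of S)).commRingCatIsoToRingEquiv _).mp hu'
  have : q = IsOpenImmersion.lift (X.basicOpen (f r)).ι q (by
      rw [Scheme.Opens.range_ι]
      rintro _ ⟨y, rfl⟩
      exact (show y ∈ q ⁻¹ᵁ (X.basicOpen (f r)) from hq ▸ trivial)) ≫ (X.basicOpen (f r)).ι := by
    simp
  generalize IsOpenImmersion.lift (X.basicOpen (f r)).ι q _ = q' at this
  subst this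
  rw [Category.assoc, ι_toProj _ _ _ hn hr]
  have key := comp_toSpecAway (f r) q' (IsLocalization.Away.lift (f r) hu')
    (fun a => by rw [IsLocalization.Away.lift_eq]; rfl)
  simp only [Proj.toBasicOpenOfGlobalSections, Category.assoc, Proj.basicOpenIsoSpec_inv_ι]
  have key2 := congrArg (fun z => z ≫ Spec.map (CommRingCat.ofHom ((IsLocalization.map
    (M := .powers r) (T := .powers (f r)) (Localization.Away (f r)) f (by
      rw [← Submonoid.map_le_iff_le_comap, Submonoid.map_powers])).comp
    (algebraMap (HomogeneousLocalization.Away 𝒜 r) (Localization.Away r)))) ≫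
    Proj.awayι 𝒜 r hr hn) key
  simp only [Category.assoc] at key2
  refine key2.trans ?_
  rw [awayLift, ← Category.assoc, ← Spec.map_comp, ← CommRingCat.ofHom_comp, ← RingHom.comp_assoc]
  congr 4
  refine IsLocalization.ringHom_ext (.powers r) ?_
  ext a
  simp [IsLocalization.map_eq, ← hφ]

/-- The preimage of `D₊(r)` is `D(f(r))`, and not just contains it. This is checked on points with
values in fields, for which `comp_toProj` describes the morphism. -/
theorem toProj_preimage_basicOpen {n : ℕ} (hn : 0 < n) {r : A} (hr : r ∈ 𝒜 n) :
    toProj 𝒜 f hf ⁻¹ᵁ Proj.basicOpen 𝒜 r = X.basicOpen (f r) := by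
  refine TopologicalSpace.Opens.ext (Set.ext fun x => ?_)
  obtain ⟨⟨m, s, hm, hs⟩, hx⟩ := TopologicalSpace.Opens.mem_iSup.mp (hf.ge (Set.mem_univ x))
  obtain ⟨S, _, q, y, rfl⟩ := exists_specField_apply_eq x
  let φ : A →+* S := ((Scheme.ΓSpecIso (CommRingCat.of S)).hom.hom.comp q.appTop.hom).comp f
  -- over a field, a point lies in `D(g)` exactly when the pullback of `g` is nonzero
  have hD : ∀ a : A, q y ∈ X.basicOpen (f a) ↔ φ a ≠ 0 := by
    intro a
    have h1 : q y ∈ X.basicOpen (f a) ↔ y ∈ (Spec (CommRingCat.of S)).basicOpen (q.appTop (f a)) := by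
      rw [← Scheme.preimage_basicOpen_top]
      rfl
    rw [h1]
    by_cases h0 : φ a = 0
    · have : q.appTop (f a) = 0 :=
        (Scheme.ΓSpecIso (CommRingCat.of S)).commRingCatIsoToRingEquiv.injective
          (h0.trans (map_zero _).symm)
      simp [this, h0]
    · have : IsUnit (q.appTop (f a)) :=
        (isUnit_map_iff (Scheme.ΓSpecIso (CommRingCat.of S)).commRingCatIsoToRingEquiv _).mp
          (Ne.isUnit h0 : IsUnit (φ a))
      simp [Scheme.basicOpen_of_isUnit _ this, h0]
  have hu : IsUnit (φ s) := ((hD s).mp hx).isUnit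
  have key := comp_toProj 𝒜 f hf q φ (fun _ => rfl) hm hs hu
  have h2 : q y ∈ toProj 𝒜 f hf ⁻¹ᵁ Proj.basicOpen 𝒜 r ↔
      y ∈ (q ≫ toProj 𝒜 f hf) ⁻¹ᵁ Proj.basicOpen 𝒜 r := by
    rw [Scheme.Hom.comp_preimage]
    rfl
  refine h2.trans (Iff.trans ?_ (hD r).symm)
  rw [key, Scheme.Hom.comp_preimage, Proj.awayι_preimage_basicOpen (𝒜 := 𝒜) hs hm hr hn]
  have hy0 : y.asIdeal = ⊥ := (Ideal.eq_bot_or_top y.asIdeal).resolve_right y.2.ne_top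
  have h3 := awayLift_mk_mul 𝒜 φ hu hs n (r ^ m)
    (by convert! SetLike.pow_mem_graded m hr using 2; exact mul_comm _ _)
  rw [map_pow] at h3
  change awayLift 𝒜 φ s hu (HomogeneousLocalization.Away.isLocalizationElem hs hr) ∉ y.asIdeal ↔ _
  rw [hy0, Ideal.mem_bot, ← not_iff_not, not_not, not_not, ← pow_eq_zero_iff (a := φ r) hm.ne',
    ← h3, mul_eq_zero, or_iff_left (pow_ne_zero _ hu.ne_zero)]

end ToProjLemmas

/-! ### Geometric quotients from charts -/

section Charts

theorem appLE_top_bijective {Z Y : Scheme.{0}} (f : Z ⟶ Y) [IsOpenImmersion f] (U : Y.Opens)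
    (h : U = f.opensRange) (e : ⊤ ≤ f ⁻¹ᵁ U) : Function.Bijective (f.appLE U ⊤ e) := by
  obtain rfl : U = f ''ᵁ ⊤ := by rw [h, Scheme.Hom.image_top_eq_opensRange]
  rw [← Scheme.Hom.appIso_hom']
  exact (f.appIso ⊤).commRingCatIsoToRingEquiv.bijective

theorem le_preimage_of_opensRange_le {Z Y : Scheme.{0}} (f : Z ⟶ Y) [IsOpenImmersion f]
    {U : Y.Opens} (h : f.opensRange ≤ U) : ⊤ ≤ f ⁻¹ᵁ U := fun x _ => h ⟨x, rfl⟩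

/-- If `b` is given by `γ` on affine charts `j` and `k`, then the pullback of functions along `b` is given
by `γ`. -/
theorem ΓSpecIso_appLE_appLE {X Y : Scheme.{0}} {R B : CommRingCat.{0}} (b : X ⟶ Y)
    (j : Spec R ⟶ X) (k : Spec B ⟶ Y) (γ : B ⟶ R) (h : j ≫ b = Spec.map γ ≫ k) {U : Y.Opens}
    {V : X.Opens} (hb : V ≤ b ⁻¹ᵁ U) (hj : ⊤ ≤ j ⁻¹ᵁ V) (hk : ⊤ ≤ k ⁻¹ᵁ U) (s : Γ(Y, U)) :
    (Scheme.ΓSpecIso R).hom (j.appLE V ⊤ hj (b.appLE U V hb s)) =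
      γ ((Scheme.ΓSpecIso B).hom (k.appLE U ⊤ hk s)) := by
  have h1 : b.appLE U V hb ≫ j.appLE V ⊤ hj = k.appLE U ⊤ hk ≫ (Spec.map γ).appTop := by
    rw [Scheme.Hom.appLE_comp_appLE]
    refine Eq.trans ?_ (((Scheme.Hom.appLE_comp_appLE (Spec.map γ) k U ⊤ ⊤ hk le_top).symm.trans
      (congrArg (k.appLE U ⊤ hk ≫ ·) (Scheme.Hom.app_eq_appLE (Spec.map γ)).symm)))
    congr 1
  have h2 := congrArg (· ≫ (Scheme.ΓSpecIso R).hom) h1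
  simp only [Category.assoc] at h2
  rw [Scheme.ΓSpecIso_naturality] at h2
  exact ConcreteCategory.congr_hom h2 s

theorem app_comp_appLE_of_comp_eq {X Y : Scheme.{0}} {b : X ⟶ X} {π : X ⟶ Y} (h : b ≫ π = π)
    (U : Y.Opens) (e : π ⁻¹ᵁ U ≤ b ⁻¹ᵁ π ⁻¹ᵁ U) (r : Γ(Y, U)) :
    b.appLE (π ⁻¹ᵁ U) (π ⁻¹ᵁ U) e (π.app U r) = π.app U r := by
  have : π.app U ≫ b.appLE (π ⁻¹ᵁ U) (π ⁻¹ᵁ U) e = π.app U := by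
    rw [Scheme.Hom.app_eq_appLE, Scheme.Hom.appLE_comp_appLE]
    congr 1
  exact ConcreteCategory.congr_hom this r

variable {G : Type} {X Y : Scheme.{0}} (a : G → (X ⟶ X)) (π : X ⟶ Y) {I : Type}
  {R B : I → CommRingCat.{0}} (j : ∀ i, Spec (R i) ⟶ X) (k : ∀ i, Spec (B i) ⟶ Y)
  [∀ i, IsOpenImmersion (j i)] [∀ i, IsOpenImmersion (k i)]
  (θ : ∀ i, B i ⟶ R i) (ρ : ∀ i, R i ⟶ B i) (α : ∀ i, G → (R i ⟶ R i))

theorem injective_app_of_charts (hπ : ∀ i, j i ≫ π = Spec.map (θ i) ≫ k i)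
    (hπ' : ∀ i, π ⁻¹ᵁ (k i).opensRange = (j i).opensRange) (hθ : ∀ i, Function.Injective (θ i))
    (hb : ∀ (U : Y.Opens), ∀ y ∈ U, ∃ i, y ∈ (k i).opensRange ∧ (k i).opensRange ≤ U)
    (U : Y.Opens) : Function.Injective (π.app U) := by
  intro r s hrs
  refine Y.sheaf.eq_of_locally_eq' (ι := {i // (k i).opensRange ≤ U})
    (fun i => (k i).opensRange) U (fun i => homOfLE i.2) (fun y hy => ?_) r s fun ⟨i, hi⟩ => ?_
  · obtain ⟨i, hi, hi'⟩ := hb U y hy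
    exact TopologicalSpace.Opens.mem_iSup.mpr ⟨⟨i, hi'⟩, hi⟩
  · refine (appLE_top_bijective (k i) _ rfl (le_preimage_of_opensRange_le _ le_rfl)).1 ?_
    have hV : (j i).opensRange ≤ π ⁻¹ᵁ U := (hπ' i).ge.trans (π.preimage_mono hi)
    have h1 : ∀ z, (Scheme.ΓSpecIso (R i)).hom
        ((j i).appLE (π ⁻¹ᵁ U) ⊤ (le_preimage_of_opensRange_le _ hV) (π.app U z)) =
        θ i ((Scheme.ΓSpecIso (B i)).hom ((k i).appLE _ ⊤
          (le_preimage_of_opensRange_le _ le_rfl) (Y.presheaf.map (homOfLE hi).op z))) := by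
      intro z
      rw [Scheme.Hom.app_eq_appLE, ΓSpecIso_appLE_appLE π (j i) (k i) (θ i) (hπ i) le_rfl _
        (le_preimage_of_opensRange_le _ hi), ← Scheme.Hom.map_appLE (k i)
        (le_preimage_of_opensRange_le _ le_rfl) (homOfLE hi).op]
      rfl
    refine (Scheme.ΓSpecIso (B i)).commRingCatIsoToRingEquiv.injective (hθ i ?_)
    exact (h1 r).symm.trans ((congrArg _ (congrArg _ hrs)).trans (h1 s))

/-- Suppose that `Y` has a basis of affine open subsets `Spec Bᵢ`, and that the preimage of `Spec Bᵢ` is an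
invariant affine open subset `Spec Rᵢ` of `X`, such that `Bᵢ → Rᵢ` identifies `Bᵢ` with the ring of
invariants in `Rᵢ` and has a retraction. If moreover closed points with the same image lie in one
orbit, then `X ⟶ Y` is a geometric quotient. The sections `Spec Bᵢ ⟶ Spec Rᵢ` given by the
retractions account for the surjectivity and for the quotient topology. -/
theorem IsGeometricQuotient.of_charts
    (hπ : ∀ i, j i ≫ π = Spec.map (θ i) ≫ k i)
    (hπ' : ∀ i, π ⁻¹ᵁ (k i).opensRange = (j i).opensRange)
    (hρ : ∀ i, θ i ≫ ρ i = 𝟙 _)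
    (ha : ∀ i g, j i ≫ a g = Spec.map (α i g) ≫ j i)
    (hα : ∀ i x, (∃ b, θ i b = x) ↔ ∀ g, α i g x = x)
    (hb : ∀ (U : Y.Opens), ∀ y ∈ U, ∃ i, y ∈ (k i).opensRange ∧ (k i).opensRange ≤ U)
    (hfib : ∀ x y : X, IsClosed {x} → IsClosed {y} → π x = π y → ∃ g, a g x = y) :
    IsGeometricQuotient a π := by
  have hsec : ∀ i, (Spec.map (ρ i) ≫ j i) ≫ π = k i := by
    intro i
    rw [Category.assoc, hπ, ← Category.assoc, ← Spec.map_comp, hρ, Spec.map_id, Category.id_comp]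
  have hk : ∀ i y, π (j i (Spec.map (ρ i) y)) = k i y := by
    intro i y
    rw [← hsec i]; rfl
  have hcov : ∀ x : X, ∃ i, x ∈ (j i).opensRange := by
    intro x
    obtain ⟨i, hi, -⟩ := hb ⊤ (π x) trivial
    exact ⟨i, hπ' i ▸ hi⟩
  have hsurj : Function.Surjective π := by
    intro y
    obtain ⟨i, ⟨z, rfl⟩, -⟩ := hb ⊤ y trivial
    exact ⟨_, hk i z⟩
  have hinv : ∀ g, a g ≫ π = π := by
    intro g
    refine Scheme.Cover.hom_ext (X.openCoverOfIsOpenCover (fun i => (j i).opensRange) ?_) _ _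
      fun (i : I) => ?_
    · exact top_le_iff.mp fun x _ => TopologicalSpace.Opens.mem_iSup.mpr (hcov x)
    · change (j i).opensRange.ι ≫ _ = (j i).opensRange.ι ≫ _
      rw [← cancel_epi (j i).isoOpensRange.hom, Scheme.Hom.isoOpensRange_hom_ι_assoc,
        Scheme.Hom.isoOpensRange_hom_ι_assoc, ← Category.assoc, ha, Category.assoc, hπ,
        ← Category.assoc, ← Spec.map_comp]
      congr 2
      ext b
      exact (hα i _).mp ⟨b, rfl⟩ g
  have hθ : ∀ i, Function.Injective (θ i) := fun i =>
    Function.LeftInverse.injective (g := ρ i) fun b => ConcreteCategory.congr_hom (hρ i) b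
  have hinj := injective_app_of_charts π j k θ hπ hπ' hθ hb
  refine ⟨hinv, ?_, hsurj, fun x y hx hy => ⟨hfib x y hx hy, ?_⟩, ?_, hinj, ?_⟩
  · refine isAffineHom_of_forall_exists_isAffineOpen _ fun y => ?_
    obtain ⟨i, hi, -⟩ := hb ⊤ y trivial
    exact ⟨_, hi, isAffineOpen_opensRange _, hπ' i ▸ isAffineOpen_opensRange _⟩
  · rintro ⟨g, rfl⟩
    exact congrArg (fun q : X ⟶ Y => q x) (hinv g).symm
  · rw [Topology.isQuotientMap_iff]
    refine ⟨Topology.isCoinducing_iff.mpr fun s => ⟨fun hs => ?_, fun hs => hs.preimage π.continuous⟩, hsurj⟩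
    rw [isOpen_iff_forall_mem_open]
    intro y hy
    obtain ⟨i, ⟨z, rfl⟩, -⟩ := hb ⊤ y trivial
    have h1 : (k i) ⁻¹' s = (Spec.map (ρ i) ≫ j i) ⁻¹' (π ⁻¹' s) := by
      ext z
      exact (show k i z ∈ s ↔ _ by rw [← hk i z]; rfl)
    have h2 : IsOpen ((k i) ⁻¹' s) := h1 ▸ hs.preimage (Spec.map (ρ i) ≫ j i).continuous
    exact ⟨_, Set.image_preimage_subset _ _, (k i).isOpenEmbedding.isOpenMap _ h2, z, hy, rfl⟩
  · intro U s
    constructor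
    · rintro ⟨r, rfl⟩ g
      exact app_comp_appLE_of_comp_eq (hinv g) U _ r
    · intro hs
      let J := {i // (k i).opensRange ≤ U}
      have hV : ∀ i : J, (j i).opensRange ≤ π ⁻¹ᵁ U := fun i =>
        (hπ' i).ge.trans (π.preimage_mono i.2)
      -- on each chart the invariant function comes from the base of the chart
      have hloc : ∀ i : J, ∃ r : Γ(Y, (k i).opensRange),
          π.app _ r = X.presheaf.map (homOfLE (π.preimage_mono i.2)).op s := by
        intro i
        have hi := le_preimage_of_opensRange_le _ (hV i)
        obtain ⟨b, hb⟩ := (hα i ((Scheme.ΓSpecIso (R i)).hom ((j i).appLE _ ⊤ hi s))).mpr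
          fun g => by
            rw [← ΓSpecIso_appLE_appLE (a g) (j i) (j i) (α i g) (ha i g)
              (by rw [← Scheme.Hom.comp_preimage, hinv]) hi hi]
            exact congrArg _ (congrArg _ (hs g))
        obtain ⟨b, rfl⟩ := (Scheme.ΓSpecIso (B i)).commRingCatIsoToRingEquiv.surjective b
        obtain ⟨r, rfl⟩ := (appLE_top_bijective (k i) _ rfl
          (le_preimage_of_opensRange_le _ le_rfl)).2 b
        refine ⟨r, ?_⟩
        have hj := le_preimage_of_opensRange_le (j i) (hπ' i).ge
        refine (appLE_top_bijective (j i) _ (hπ' i) hj).1 ?_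
        refine (Scheme.ΓSpecIso (R i)).commRingCatIsoToRingEquiv.injective ?_
        have h1 := ΓSpecIso_appLE_appLE π (j i) (k i) (θ i) (hπ i) le_rfl hj
          (le_preimage_of_opensRange_le _ le_rfl) r
        rw [← Scheme.Hom.app_eq_appLE] at h1
        refine h1.trans (hb.trans ?_)
        rw [← Scheme.Hom.map_appLE (j i) hj (homOfLE (π.preimage_mono i.2)).op]
        rfl
      choose r hr using hloc
      have hnat : ∀ {V W : Y.Opens} (h : V ≤ W) (z : Γ(Y, W)), π.app V
          (Y.presheaf.map (homOfLE h).op z) =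
            X.presheaf.map (homOfLE (π.preimage_mono h)).op (π.app W z) := by
        intro V W h z
        exact ConcreteCategory.congr_hom (π.naturality (homOfLE h).op) z
      have hcU : U ≤ ⨆ i : J, (k i).opensRange := fun y hy => by
        obtain ⟨i, hi, hi'⟩ := hb U y hy
        exact TopologicalSpace.Opens.mem_iSup.mpr ⟨⟨i, hi'⟩, hi⟩
      have hcompat : TopCat.Presheaf.IsCompatible Y.sheaf.1
          (fun i : J => (k i).opensRange) r := by
        intro i i'
        apply hinj
        refine (hnat inf_le_left (r i)).trans (Eq.trans ?_ (hnat inf_le_right (r i')).symm)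
        rw [hr, hr, ← ConcreteCategory.comp_apply, ← ConcreteCategory.comp_apply,
          ← Functor.map_comp, ← Functor.map_comp]
        rfl
      obtain ⟨t, ht, -⟩ := Y.sheaf.existsUnique_gluing' (fun i : J => (k i).opensRange) U
        (fun i => homOfLE i.2) hcU r hcompat
      refine ⟨t, ?_⟩
      refine X.sheaf.eq_of_locally_eq' (fun i : J => π ⁻¹ᵁ (k i).opensRange) (π ⁻¹ᵁ U)
        (fun i => homOfLE (π.preimage_mono i.2)) (fun x hx => ?_) _ _ fun i => ?_
      · obtain ⟨i, hi, hi'⟩ := hb U (π x) hx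
        exact TopologicalSpace.Opens.mem_iSup.mpr ⟨⟨i, hi'⟩, hi⟩
      · exact (hnat i.2 t).symm.trans ((congrArg _ (ht i)).trans (hr i))

end Charts

/-! ### The grading of `ℛ` and the generators -/

theorem coeff_ambAct (t : TLam) (F : Amb) (v : Lam) :
    (ambAct t F).coeff v = chi v t • F.coeff v := by
  induction F using AddMonoidAlgebra.induction_linear with
  | zero => simp
  | add f g hf hg => simp [hf, hg]
  | single u p =>
    rw [ambAct_single, AddMonoidAlgebra.coeff_smul, AddMonoidAlgebra.coeff_single]
    by_cases h : u = v
    · subst h; simp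
    · simp [Finsupp.single_eq_of_ne' h]

theorem mem_piece_iff {u : Lam} {f : RR} :
    f ∈ piece u ↔ ∀ v, v ≠ u → (incl f).coeff v = 0 := by
  constructor
  · rintro ⟨p, hp⟩ v hv
    rw [hp, AddMonoidAlgebra.coeff_single, Finsupp.single_eq_of_ne hv]
  · intro h
    refine ⟨(incl f).coeff u, ?_⟩
    ext v : 2
    by_cases hv : v = u
    · subst hv; simp
    · rw [h v hv, AddMonoidAlgebra.coeff_single, Finsupp.single_eq_of_ne hv]

theorem exists_chi_ne {u v : Lam} (h : u ≠ v) : ∃ t, chi u t ≠ chi v t := by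
  obtain ⟨i, hi⟩ := Function.ne_iff.mp fun e => h (Subtype.ext e)
  let c : ℂˣ := Units.mk0 2 two_ne_zero
  refine ⟨{ toFun := fun w => c ^ ((Multiplicative.toAdd w : Lam) : Fin 5 → ℤ) i
            map_one' := by simp
            map_mul' := fun a b => by simp [zpow_add] }, ?_⟩
  intro e
  have e' : (2 : ℂ) ^ ((u : Fin 5 → ℤ) i) = 2 ^ ((v : Fin 5 → ℤ) i) := by
    simpa [chi, c] using e
  have e'' : (2 : ℝ) ^ ((u : Fin 5 → ℤ) i) = 2 ^ ((v : Fin 5 → ℤ) i) := by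
    apply Complex.ofReal_injective
    simpa using e'
  exact hi (zpow_right_injective₀ two_pos (by norm_num) e'')

/-- The semi-invariants of weight `u` are the elements of degree `u`, as distinct elements of `Λ` are
distinct characters of the torus. -/
theorem mem_piece_of_act {u : Lam} {f : RR} (h : ∀ t, act t f = chi u t • f) : f ∈ piece u := by
  rw [mem_piece_iff]
  intro v hv
  obtain ⟨t, ht⟩ := exists_chi_ne hv
  have h1 := congrArg (fun F : Amb => F.coeff v) (congrArg incl (h t))
  simp only [incl_act, coeff_ambAct, map_smul, AddMonoidAlgebra.coeff_smul, Finsupp.smul_apply]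
    at h1
  rw [← sub_eq_zero, ← sub_smul, smul_eq_zero] at h1
  exact h1.resolve_left (sub_ne_zero.mpr ht)

instance : UniqueSums Lam :=
  UniqueSums.of_injective_addHom Lam.subtype.toAddHom Subtype.val_injective inferInstance

instance : IsDomain RR :=
  incl_injective.isDomain incl

/-- The forms `φ_{ij}`, with the signs of `φ₁₂`, `φ₁₄`, `φ₃₄` reversed. With these signs the
three-term relations between the `φ_{ij}` take the standard Plücker form. -/
def phiSgn : Fin 5 → Fin 5 → CV
  | 1, 2 => -phi 1 2
  | 1, 4 => -phi 1 4
  | 3, 4 => -phi 3 4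
  | i, j => phi i j

/-- The skew-symmetric matrix with entries `± φ_{ij}` which has the Plücker relations of a matrix
of rank two. -/
def phiSkew (i j : Fin 5) : CV := if i < j then phiSgn i j else -phiSgn j i

theorem phiSgn_self (i : Fin 5) : phiSgn i i = 0 := by
  fin_cases i <;> rfl

theorem phiSgn_eq_or (i j : Fin 5) : phiSgn i j = phi i j ∨ phiSgn i j = -phi i j := by
  fin_cases i <;> fin_cases j <;> first | exact Or.inl rfl | exact Or.inr rfl

theorem phiSkew_swap (i j : Fin 5) : phiSkew j i = -phiSkew i j := by
  rcases lt_trichotomy i j with h | h | h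
  · simp [phiSkew, h, h.not_gt]
  · subst h; simp [phiSkew, phiSgn_self]
  · simp [phiSkew, h, h.not_gt]

theorem phiSkew_of_lt {i j : Fin 5} (h : i < j) : phiSkew i j = phiSgn i j := if_pos h

theorem degW_comm (i j : Fin 5) : degW i j = degW j i := Subtype.ext (add_comm _ _)

theorem single_phiSkew_mem (i j : Fin 5) :
    AddMonoidAlgebra.single (degW i j) (phiSkew i j) ∈ ringR := by
  have hlt : ∀ i j : Fin 5, i < j →
      AddMonoidAlgebra.single (degW i j) (phiSkew i j) ∈ ringR := by
    intro i j h
    have h1 : AddMonoidAlgebra.single (degW i j) (phi i j) ∈ ringR :=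
      Algebra.subset_adjoin (Or.inl ⟨i, j, h, rfl⟩)
    rw [phiSkew_of_lt h]
    rcases phiSgn_eq_or i j with h2 | h2 <;> rw [h2]
    · exact h1
    · rw [AddMonoidAlgebra.single_neg]
      exact ringR.neg_mem h1
  rcases lt_trichotomy i j with h | h | h
  · exact hlt i j h
  · subst h; simp [phiSkew, phiSgn_self]
  · rw [phiSkew_swap j i, degW_comm, AddMonoidAlgebra.single_neg]
    exact ringR.neg_mem (hlt j i h)

/-- The element `± φ_{ij} t_i t_j` of `ℛ`, with the signs chosen as in `phiSkew`. -/
def ww (i j : Fin 5) : RR := (⟨_, single_phiSkew_mem i j⟩ : ringR)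

/-- The element `t_k⁻²` of `ℛ`. -/
def uu (k : Fin 5) : RR :=
  (⟨AddMonoidAlgebra.single (degU k) 1, Algebra.subset_adjoin (Or.inr ⟨k, rfl⟩)⟩ : ringR)

theorem incl_ww (i j : Fin 5) :
    incl (ww i j) = AddMonoidAlgebra.single (degW i j) (phiSkew i j) := rfl

theorem incl_uu (k : Fin 5) : incl (uu k) = AddMonoidAlgebra.single (degU k) 1 := rfl

theorem ww_mem_piece (i j : Fin 5) : ww i j ∈ piece (degW i j) := ⟨_, incl_ww i j⟩

theorem uu_mem_piece (k : Fin 5) : uu k ∈ piece (degU k) := ⟨_, incl_uu k⟩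

theorem ww_swap (i j : Fin 5) : ww j i = -ww i j := by
  apply incl_injective
  rw [map_neg, incl_ww, incl_ww, phiSkew_swap, degW_comm, AddMonoidAlgebra.single_neg]

theorem ww_self (i : Fin 5) : ww i i = 0 := by
  apply incl_injective
  rw [incl_ww, map_zero]
  simp [phiSkew, phiSgn_self]

theorem phi_zero_one_ne_zero : phi 0 1 ≠ 0 := by
  intro h
  have := congrArg (MvPolynomial.eval ![1, 0, 0, 1]) h
  simp [phi] at this

/-- As `φ₀₁ ≠ 0`, the matrix `phiSkew` is determined by its first two rows; this is the reason for the
Plücker relations. -/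
theorem phi_zero_one_mul (i j : Fin 5) :
    phi 0 1 * phiSkew i j = phiSkew 0 i * phiSkew 1 j - phiSkew 0 j * phiSkew 1 i := by
  have hI : (MvPolynomial.C Complex.I : CV) ^ 2 = -1 := by
    rw [← map_pow, Complex.I_sq, map_neg, map_one]
  have hlt : ∀ i j : Fin 5, i < j →
      phi 0 1 * phiSkew i j = phiSkew 0 i * phiSkew 1 j - phiSkew 0 j * phiSkew 1 i := by
    intro i j h
    fin_cases i <;> fin_cases j <;> simp [phiSkew, phiSgn, phi] at h ⊢ <;> grind
  rcases lt_trichotomy i j with h | h | h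
  · exact hlt i j h
  · subst h; simp [phiSkew, phiSgn_self]
  · rw [phiSkew_swap j i]
    linear_combination -hlt j i h

theorem phiSkew_plucker (i j k l : Fin 5) :
    phiSkew i j * phiSkew k l - phiSkew i k * phiSkew j l + phiSkew i l * phiSkew j k = 0 := by
  have h := phi_zero_one_mul
  refine (mul_eq_zero.mp ?_).resolve_left (pow_ne_zero 2 phi_zero_one_ne_zero)
  have : ∀ a b c d : Fin 5, phi 0 1 ^ 2 * (phiSkew a b * phiSkew c d) =
      (phi 0 1 * phiSkew a b) * (phi 0 1 * phiSkew c d) := fun a b c d => by ring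
  rw [mul_add, mul_sub, this, this, this, h, h, h, h, h, h]
  ring

theorem ww_plucker (i j k l : Fin 5) :
    ww i j * ww k l - ww i k * ww j l + ww i l * ww j k = 0 := by
  apply incl_injective
  simp only [map_add, map_sub, map_mul, map_zero, incl_ww, AddMonoidAlgebra.single_mul_single]
  have h1 : degW i k + degW j l = degW i j + degW k l :=
    Subtype.ext (add_add_add_comm _ _ _ _)
  have h2 : degW i l + degW j k = degW i j + degW k l := by
    rw [degW_comm k l]
    exact Subtype.ext (add_add_add_comm _ _ _ _)
  rw [h1, h2, ← AddMonoidAlgebra.single_sub, ← AddMonoidAlgebra.single_add, phiSkew_plucker,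
    AddMonoidAlgebra.single_zero]

theorem adjoin_generators : Algebra.adjoin ℂ
    (Set.range (fun p : Fin 5 × Fin 5 => ww p.1 p.2) ∪ Set.range uu) = ⊤ := by
  set S := Algebra.adjoin ℂ (Set.range (fun p : Fin 5 × Fin 5 => ww p.1 p.2) ∪ Set.range uu)
  have h : ringR ≤ S.map incl := by
    refine Algebra.adjoin_le ?_
    rintro x (⟨i, j, hij, rfl⟩ | ⟨k, rfl⟩)
    · have h1 : ww i j ∈ S := Algebra.subset_adjoin (Or.inl ⟨(i, j), rfl⟩)
      rcases phiSgn_eq_or i j with h2 | h2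
      · exact ⟨ww i j, h1, by rw [← h2, ← phiSkew_of_lt hij]; rfl⟩
      · refine ⟨-ww i j, S.neg_mem h1, ?_⟩
        rw [← neg_eq_iff_eq_neg] at h2
        rw [← h2, ← phiSkew_of_lt hij, AddMonoidAlgebra.single_neg, ← incl_ww]
        exact map_neg incl _
    · exact ⟨uu k, Algebra.subset_adjoin (Or.inr ⟨k, rfl⟩), rfl⟩
  refine top_le_iff.mp fun f _ => ?_
  obtain ⟨g, hg, hgf⟩ := h (show incl f ∈ ringR from f.2)
  exact incl_injective hgf ▸ hg

instance : Algebra.FiniteType ℂ RR :=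
  ⟨⟨((Set.finite_range _).union (Set.finite_range _)).toFinset, by
    rw [Set.Finite.coe_toFinset]; exact adjoin_generators⟩⟩

/-- The submonoid of `Λ` generated by the degrees of those generators `φ_{ij} t_i t_j`, `t_k⁻²` of
`ℛ` which do not lie in the ideal `P`. -/
def degMonoid (P : Ideal RR) : AddSubmonoid Lam :=
  AddSubmonoid.closure ({v | ∃ i j, ww i j ∉ P ∧ v = degW i j} ∪ {v | ∃ k, uu k ∉ P ∧ v = degU k})

/-- The homogeneous components of an element of `ℛ` lie in `ℛ`. Moreover, a component lies in `P` unless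
its degree is the degree of a monomial in generators outside of `P`. -/
theorem exists_mem_piece_coeff (P : Ideal RR) (f : RR) (u : Lam) :
    ∃ g ∈ piece u, (incl g).coeff u = (incl f).coeff u ∧ (u ∈ degMonoid P ∨ g ∈ P) := by
  have hf : f ∈ Submodule.span ℂ (Submonoid.closure
      (Set.range (fun p : Fin 5 × Fin 5 => ww p.1 p.2) ∪ Set.range uu) : Set RR) := by
    rw [← Algebra.adjoin_eq_span, adjoin_generators]; trivial
  induction hf using Submodule.span_induction with
  | zero => exact ⟨0, zero_mem _, rfl, Or.inr (zero_mem _)⟩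
  | add f g _ _ hf hg =>
    obtain ⟨f', h1, h2, h3⟩ := hf
    obtain ⟨g', k1, k2, k3⟩ := hg
    refine ⟨f' + g', add_mem h1 k1, by simp [h2, k2], ?_⟩
    by_cases hu : u ∈ degMonoid P
    · exact Or.inl hu
    · exact Or.inr (add_mem (h3.resolve_left hu) (k3.resolve_left hu))
  | smul c f _ hf =>
    obtain ⟨f', h1, h2, h3⟩ := hf
    refine ⟨c • f', Submodule.smul_mem _ _ h1, by simp [h2], h3.imp_right fun h => ?_⟩
    rw [Algebra.smul_def]
    exact P.mul_mem_left _ h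
  | mem f hf =>
    have key : ∃ v, f ∈ piece v ∧ (v ∈ degMonoid P ∨ f ∈ P) := by
      induction hf using Submonoid.closure_induction with
      | mem x hx =>
        rcases hx with ⟨⟨i, j⟩, rfl⟩ | ⟨k, rfl⟩
        · refine ⟨_, ww_mem_piece i j, or_iff_not_imp_right.mpr fun h => ?_⟩
          exact AddSubmonoid.subset_closure (Or.inl ⟨i, j, h, rfl⟩)
        · refine ⟨_, uu_mem_piece k, or_iff_not_imp_right.mpr fun h => ?_⟩
          exact AddSubmonoid.subset_closure (Or.inr ⟨k, h, rfl⟩)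
      | one => exact ⟨0, one_mem_piece, Or.inl (zero_mem _)⟩
      | mul x y _ _ hx hy =>
        obtain ⟨v, h1, h2⟩ := hx
        obtain ⟨w, k1, k2⟩ := hy
        refine ⟨v + w, mul_mem_piece h1 k1, ?_⟩
        rcases h2 with h2 | h2
        · rcases k2 with k2 | k2
          · exact Or.inl (add_mem h2 k2)
          · exact Or.inr (P.mul_mem_left _ k2)
        · exact Or.inr (P.mul_mem_right _ h2)
    obtain ⟨v, h1, h2⟩ := key
    by_cases hv : v = u
    · subst hv; exact ⟨f, h1, rfl, h2⟩
    · refine ⟨0, zero_mem _, ?_, Or.inr (zero_mem _)⟩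
      rw [mem_piece_iff.mp h1 u (Ne.symm hv)]; simp

theorem eq_of_mem_piece {u : Lam} {f f' : RR} (hf : f ∈ piece u) (hf' : f' ∈ piece u)
    (h : (incl f).coeff u = (incl f').coeff u) : f = f' := by
  apply incl_injective
  obtain ⟨p, hp⟩ := hf
  obtain ⟨q, hq⟩ := hf'
  rw [hp, hq] at h ⊢
  simp only [AddMonoidAlgebra.coeff_single, Finsupp.single_eq_same] at h
  rw [h]

theorem mem_degMonoid {P : Ideal RR} {f : RR} {u : Lam} (hf : f ∈ piece u) (hP : f ∉ P) :
    u ∈ degMonoid P := by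
  obtain ⟨g, h1, h2, h3⟩ := exists_mem_piece_coeff P f u
  refine h3.resolve_right fun h => hP ?_
  rwa [eq_of_mem_piece hf h1 h2.symm]

/-! ### Good sections -/

theorem pow_mem_piece {u : Lam} {f : RR} (hf : f ∈ piece u) (k : ℕ) : f ^ k ∈ piece (k • u) := by
  induction k with
  | zero => simpa using one_mem_piece
  | succ k ih =>
    rw [pow_succ, succ_nsmul]
    exact mul_mem_piece ih hf

/-- For `g` homogeneous of degree `w`, the degrees `u` for which the localization `ℛ_g` has a
homogeneous unit `s / g^k` of degree `u`, with inverse `s' / g^k`. -/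
def unitDegrees (w : Lam) (g : RR) : AddSubgroup Lam where
  carrier := {u | ∃ k : ℕ, ∃ s ∈ piece (k • w + u), ∃ s' ∈ piece (k • w - u), s * s' = g ^ (2 * k)}
  zero_mem' := ⟨0, 1, by simpa using one_mem_piece, 1, by simpa using one_mem_piece, by simp⟩
  add_mem' := by
    rintro u v ⟨k, s, hs, s', hs', h⟩ ⟨l, t, ht, t', ht', h'⟩
    refine ⟨k + l, s * t, ?_, s' * t', ?_, ?_⟩
    · convert mul_mem_piece hs ht using 1
      rw [add_nsmul]; abel_nf
    · convert mul_mem_piece hs' ht' using 1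
      rw [add_nsmul]; abel_nf
    · rw [mul_mul_mul_comm, h, h']; ring
  neg_mem' := by
    rintro u ⟨k, s, hs, s', hs', h⟩
    exact ⟨k, s', by rwa [← sub_eq_add_neg], s, by rwa [sub_neg_eq_add], by rw [mul_comm, h]⟩

/-- `g` is homogeneous of degree `n κ`, and `ℛ_g` has homogeneous units of all degrees. The torus
then acts freely on `D(g)` and `D(g)` is a trivial torus bundle over its quotient. -/
def IsGood (n : ℕ) (g : RR) : Prop :=
  g ∈ piece (n • kappa) ∧ unitDegrees (n • kappa) g = ⊤

theorem IsGood.mul {n m : ℕ} {g h : RR} (hg : IsGood n g) (hh : h ∈ piece (m • kappa)) :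
    IsGood (n + m) (g * h) := by
  refine ⟨by rw [add_nsmul]; exact mul_mem_piece hg.1 hh, top_le_iff.mp fun u _ => ?_⟩
  obtain ⟨k, s, hs, s', hs', e⟩ : u ∈ unitDegrees (n • kappa) g := hg.2 ▸ trivial
  have hk := pow_mem_piece hh k
  refine ⟨k, s * h ^ k, ?_, s' * h ^ k, ?_, ?_⟩
  · convert mul_mem_piece hs hk using 1
    rw [add_nsmul, nsmul_add]; abel_nf
  · convert mul_mem_piece hs' hk using 1
    rw [add_nsmul, nsmul_add]; abel_nf
  · rw [mul_mul_mul_comm, e]; ring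

theorem list_prod_mem_piece (L : List (RR × Lam)) (hL : ∀ x ∈ L, x.1 ∈ piece x.2) :
    (L.map Prod.fst).prod ∈ piece (L.map Prod.snd).sum := by
  induction L with
  | nil => simpa using one_mem_piece
  | cons x L ih =>
    simp only [List.map_cons, List.prod_cons, List.sum_cons]
    exact mul_mem_piece (hL x (by simp)) (ih fun y hy => hL y (by simp [hy]))

/-- The factors of a product of homogeneous elements are units where the product is invertible. -/
theorem mem_unitDegrees_of_mem_list (L : List (RR × Lam)) (hL : ∀ x ∈ L, x.1 ∈ piece x.2)
    {x : RR × Lam} (hx : x ∈ L) :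
    x.2 ∈ unitDegrees (L.map Prod.snd).sum (L.map Prod.fst).prod := by
  obtain ⟨l₁, l₂, rfl⟩ := List.append_of_mem hx
  have h1 : (l₁ ++ x :: l₂).Perm (x :: (l₁ ++ l₂)) := List.perm_middle
  set L' := l₁ ++ l₂
  set L := l₁ ++ x :: l₂
  have h2 : (L.map Prod.snd).sum = x.2 + (L'.map Prod.snd).sum := by
    rw [(h1.map Prod.snd).sum_eq]; simp
  have h3 : (L.map Prod.fst).prod = x.1 * (L'.map Prod.fst).prod := by
    rw [(h1.map Prod.fst).prod_eq]; simp
  have h4 := list_prod_mem_piece L' fun y hy => hL y (h1.mem_iff.mpr (by simp [hy]))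
  have hx1 := hL x hx
  rw [h2, h3]
  refine ⟨1, x.1 * (x.1 * (L'.map Prod.fst).prod), ?_, (L'.map Prod.fst).prod, ?_, by ring⟩
  · convert mul_mem_piece hx1 (mul_mem_piece hx1 h4) using 1
    rw [one_nsmul]; abel_nf
  · convert h4 using 1
    rw [one_nsmul]; abel_nf

theorem eq_top_of_degW_mem (D : AddSubgroup Lam) (a : Fin 5) (h : ∀ i, degW i a ∈ D) : D = ⊤ := by
  refine top_le_iff.mp fun u _ => ?_
  obtain ⟨m, hm⟩ := u.2
  have : u = ∑ i, (u : Fin 5 → ℤ) i • degW i a - m • degW a a := by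
    refine Subtype.ext (funext fun x => ?_)
    simp only [AddSubgroup.coe_sub, AddSubgroup.coe_zsmul, AddSubgroup.val_finsetSum, Pi.sub_apply,
      Finset.sum_apply, Pi.smul_apply, degW, Pi.add_apply, smul_eq_mul, mul_add,
      Finset.sum_add_distrib, ← Finset.sum_mul, hm, Pi.single_apply]
    by_cases hx : x = a <;> simp [hx]
  rw [this]
  exact D.sub_mem (D.sum_mem fun i _ => D.zsmul_mem (h i) _) (D.zsmul_mem (h a) _)

theorem pairwise_of_nodup {a b c d e : Fin 5} (h : [a, b, c, d, e].Nodup) :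
    a ≠ b ∧ a ≠ c ∧ a ≠ d ∧ a ≠ e ∧ b ≠ c ∧ b ≠ d ∧ b ≠ e ∧ c ≠ d ∧ c ≠ e ∧ d ≠ e := by
  simpa [and_assoc] using h

theorem sum_single_of_nodup {a b c d e : Fin 5} (h : [a, b, c, d, e].Nodup) :
    (Pi.single a 1 + Pi.single b 1 + Pi.single c 1 + Pi.single d 1 +
      Pi.single e 1 : Fin 5 → ℤ) = 1 := by
  have h1 : (Finset.univ : Finset (Fin 5)) = [a, b, c, d, e].toFinset := by
    refine (Finset.eq_univ_of_card _ ?_).symm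
    rw [List.toFinset_card_of_nodup h]; rfl
  have h2 : (1 : Fin 5 → ℤ) = ∑ i, Pi.single i (1 : ℤ) := (Finset.univ_sum_single _).symm
  rw [h2, h1, List.sum_toFinset _ h]
  simp [add_assoc]

/-- A monomial of degree `κ` is good if the degrees of its factors generate `Λ`. -/
theorem isGood_list {L : List (RR × Lam)} (hL : ∀ x ∈ L, x.1 ∈ piece x.2)
    (hsum : (L.map Prod.snd).sum = kappa) (a : Fin 5)
    (ha : ∀ D : AddSubgroup Lam, (∀ x ∈ L, x.2 ∈ D) → ∀ i, degW i a ∈ D) :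
    IsGood 1 (L.map Prod.fst).prod := by
  rw [IsGood, one_nsmul, ← hsum]
  exact ⟨list_prod_mem_piece L hL, eq_top_of_degW_mem _ a
    (ha _ fun x hx => mem_unitDegrees_of_mem_list L hL hx)⟩

theorem forall_of_nodup {a b c d e : Fin 5} (h : [a, b, c, d, e].Nodup) {p : Fin 5 → Prop}
    (ha : p a) (hb : p b) (hc : p c) (hd : p d) (he : p e) (i : Fin 5) : p i := by
  have h1 : [a, b, c, d, e].toFinset = Finset.univ := by
    refine Finset.eq_univ_of_card _ ?_
    rw [List.toFinset_card_of_nodup h]; rfl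
  have h2 : i ∈ [a, b, c, d, e].toFinset := h1 ▸ Finset.mem_univ i
  simp only [List.mem_toFinset, List.mem_cons, List.not_mem_nil, or_false] at h2
  rcases h2 with rfl | rfl | rfl | rfl | rfl <;> assumption

/-- The pair of the element `± φ_{ij} t_i t_j` and its degree. -/
def wP (i j : Fin 5) : RR × Lam := (ww i j, degW i j)

/-- The pair of the element `t_k⁻²` and its degree. -/
def uP (k : Fin 5) : RR × Lam := (uu k, degU k)

theorem degW_coe (i j : Fin 5) : (degW i j : Fin 5 → ℤ) = Pi.single i 1 + Pi.single j 1 := rfl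

theorem degU_coe (k : Fin 5) : (degU k : Fin 5 → ℤ) = -2 * Pi.single k 1 := by
  ext x
  by_cases h : x = k
  · subst h; simp [degU]
  · simp [degU, h]

theorem kappa_coe : (kappa : Fin 5 → ℤ) = 2 := rfl

theorem degW_add_degU (k : Fin 5) : degW k k + degU k = 0 := by
  apply Subtype.ext
  rw [AddSubgroup.coe_add, degW_coe, degU_coe, AddSubgroup.coe_zero]
  ring

theorem degW_trans {D : AddSubgroup Lam} {i j k : Fin 5} (h1 : degW i j ∈ D) (h2 : degW j k ∈ D)
    (h3 : degW k k ∈ D) : degW i k ∈ D := by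
  have : degW i k = degW i j - degW j k + degW k k := by
    apply Subtype.ext
    simp only [AddSubgroup.coe_add, AddSubgroup.coe_sub, degW_coe]
    ring
  rw [this]
  exact D.add_mem (D.sub_mem h1 h2) h3

/-- The monomial of a `5`-cycle. -/
theorem isGood_cycle {a b c d e : Fin 5} (h : [a, b, c, d, e].Nodup) :
    IsGood 1 ([wP a b, wP b c, wP c d, wP d e, wP e a].map Prod.fst).prod := by
  refine isGood_list ?_ ?_ a ?_
  · simp [wP, ww_mem_piece]
  · apply Subtype.ext
    simp only [wP, List.map_cons, List.map_nil, List.sum_cons, List.sum_nil, AddSubgroup.coe_add,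
      degW_coe, kappa_coe, AddSubgroup.coe_zero]
    linear_combination 2 * sum_single_of_nodup h
  · intro D hD
    simp only [wP, List.forall_mem_cons] at hD
    obtain ⟨h1, h2, h3, h4, h5, -⟩ := hD
    -- the alternating sum around the odd cycle
    have haa : degW a a ∈ D := by
      have : degW a a = degW a b - degW b c + degW c d - degW d e + degW e a := by
        apply Subtype.ext
        simp only [AddSubgroup.coe_add, AddSubgroup.coe_sub, degW_coe]
        ring
      rw [this]
      exact D.add_mem (D.sub_mem (D.add_mem (D.sub_mem h1 h2) h3) h4) h5
    have hba : degW b a ∈ D := degW_comm a b ▸ h1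
    refine forall_of_nodup h haa hba ?_ ?_ h5
    · exact degW_trans (degW_comm b c ▸ h2) hba haa
    · exact degW_trans h4 h5 haa

/-- The monomial used at points where `w_{ij} = 0` for `i, j` in the class `{a, b, c}`. In the
product of the `w_{ij}` the exponent of `t_e` is `4` instead of `2`, which the factor `u_e` corrects. -/
theorem isGood_three_one_one {a b c d e : Fin 5} (h : [a, b, c, d, e].Nodup) :
    IsGood 1 ([wP d a, wP e a, wP d b, wP e b, wP e c, wP e c, uP e].map Prod.fst).prod := by
  refine isGood_list ?_ ?_ e ?_
  · simp [wP, uP, ww_mem_piece, uu_mem_piece]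
  · apply Subtype.ext
    simp only [wP, uP, List.map_cons, List.map_nil, List.sum_cons, List.sum_nil,
      AddSubgroup.coe_add, degW_coe, degU_coe, kappa_coe, AddSubgroup.coe_zero]
    linear_combination 2 * sum_single_of_nodup h
  · intro D hD
    simp only [wP, uP, List.forall_mem_cons] at hD
    obtain ⟨h1, h2, -, h3, h4, -, h5, -⟩ := hD
    have hee : degW e e ∈ D := by
      rw [eq_neg_of_add_eq_zero_left (degW_add_degU e)]
      exact D.neg_mem h5
    have hae : degW a e ∈ D := degW_comm e a ▸ h2
    exact forall_of_nodup h hae (degW_comm e b ▸ h3) (degW_comm e c ▸ h4)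
      (degW_trans h1 hae hee) hee

/-- The monomial used at points where `w_{ij} = 0` for `i, j` in the class `{a, b, c, d}`. In the
product of the `w_{ij}` the exponent of `t_e` is `8` instead of `2`, whence the factor `u_e³`. -/
theorem isGood_four_one {a b c d e : Fin 5} (h : [a, b, c, d, e].Nodup) :
    IsGood 1 ([wP e a, wP e a, wP e b, wP e b, wP e c, wP e c, wP e d, wP e d, uP e, uP e,
      uP e].map Prod.fst).prod := by
  refine isGood_list ?_ ?_ e ?_
  · simp [wP, uP, ww_mem_piece, uu_mem_piece]
  · apply Subtype.ext
    simp only [wP, uP, List.map_cons, List.map_nil, List.sum_cons, List.sum_nil,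
      AddSubgroup.coe_add, degW_coe, degU_coe, kappa_coe, AddSubgroup.coe_zero]
    linear_combination 2 * sum_single_of_nodup h
  · intro D hD
    simp only [wP, uP, List.forall_mem_cons] at hD
    obtain ⟨h1, -, h2, -, h3, -, h4, -, h5, -⟩ := hD
    have hee : degW e e ∈ D := by
      rw [eq_neg_of_add_eq_zero_left (degW_add_degU e)]
      exact D.neg_mem h5
    exact forall_of_nodup h (degW_comm e a ▸ h1) (degW_comm e b ▸ h2) (degW_comm e c ▸ h3)
      (degW_comm e d ▸ h4) hee

/-! ### Good sections at semistable points -/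

section Semistable

variable {P : Ideal RR} {n : ℕ} {f : RR}

theorem ww_swap_mem_iff {i j : Fin 5} : ww j i ∈ P ↔ ww i j ∈ P := by
  rw [ww_swap, neg_mem_iff]

/-- A linear inequality which holds for the degrees of the generators of `ℛ` outside of `P` holds
for the degrees of all homogeneous elements outside of `P`. -/
theorem sum_nonneg_of_notMem {u : Lam} (hf : f ∈ piece u) (hP : f ∉ P) (c : Fin 5 → ℤ)
    (hw : ∀ i j, ww i j ∉ P → 0 ≤ c i + c j) (hu : ∀ k, uu k ∉ P → c k ≤ 0) :
    0 ≤ ∑ i, c i * (u : Fin 5 → ℤ) i := by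
  have h := mem_degMonoid hf hP
  clear hf
  induction h using AddSubmonoid.closure_induction with
  | mem x hx =>
    rcases hx with ⟨i, j, h, rfl⟩ | ⟨k, h, rfl⟩
    · simpa [degW_coe, mul_add, Finset.sum_add_distrib, Pi.single_apply] using hw i j h
    · have := hu k h
      simp [degU, Pi.single_apply]
      linarith
  | zero => simp
  | add x y _ _ hx hy =>
    simp only [AddSubgroup.coe_add, Pi.add_apply, mul_add, Finset.sum_add_distrib]
    exact add_nonneg hx hy

theorem sum_nonneg_of_notMem_kappa (hn : 0 < n) (hf : f ∈ piece (n • kappa)) (hP : f ∉ P)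
    (c : Fin 5 → ℤ) (hw : ∀ i j, ww i j ∉ P → 0 ≤ c i + c j) (hu : ∀ k, uu k ∉ P → c k ≤ 0) :
    0 ≤ ∑ i, c i := by
  have h := sum_nonneg_of_notMem hf hP c hw hu
  have h1 : ∀ i, ((n • kappa : Lam) : Fin 5 → ℤ) i = n * 2 := by
    intro i
    simp [kappa]
  simp only [h1, ← Finset.sum_mul] at h
  exact nonneg_of_mul_nonneg_left h (by positivity)

/-- If all `w_{ij}` were in `P` for some `i`, the `i`-th coordinates of the degrees of the homogeneous
elements outside of `P` could not be positive. -/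
theorem exists_ww_notMem (hn : 0 < n) (hf : f ∈ piece (n • kappa)) (hP : f ∉ P) (i : Fin 5) :
    ∃ j, ww i j ∉ P := by
  by_contra! H
  have h := sum_nonneg_of_notMem_kappa hn hf hP (-Pi.single i 1) (fun j k hjk => ?_) fun k _ => ?_
  · simp at h
  · have h1 : j ≠ i := by rintro rfl; exact hjk (H k)
    have h2 : k ≠ i := by rintro rfl; exact hjk (ww_swap_mem_iff.mpr (H j))
    simp [h1, h2]
  · simp only [Pi.neg_apply, Pi.single_apply]
    split_ifs <;> simp

/-- The Plücker relations make vanishing of `w_{ij}` a transitive relation. -/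
theorem ww_trans [P.IsPrime] (hn : 0 < n) (hf : f ∈ piece (n • kappa)) (hP : f ∉ P)
    {i j k : Fin 5} (h1 : ww i j ∈ P) (h2 : ww j k ∈ P) : ww i k ∈ P := by
  obtain ⟨l, hl⟩ := exists_ww_notMem hn hf hP j
  refine (Ideal.IsPrime.mem_or_mem ‹_› ?_).resolve_right hl
  have h := ww_plucker i j k l
  have : ww i k * ww j l = ww i j * ww k l + ww i l * ww j k := by linear_combination -h
  rw [this]
  exact P.add_mem (P.mul_mem_right _ h1) (P.mul_mem_left _ h2)

/-- If all `φ_{ij} t_i t_j` with `i, j` outside of a set `E` of at most two indices vanish, then some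
`t_k⁻²` with `k ∈ E` does not: otherwise the sum of the coordinates outside of `E` would be at most
the sum of the coordinates in `E`, for all degrees of nonvanishing elements. -/
theorem exists_uu_notMem (hn : 0 < n) (hf : f ∈ piece (n • kappa)) (hP : f ∉ P)
    (E : Finset (Fin 5)) (hE : E.card ≤ 2) (hw : ∀ i j, i ∉ E → j ∉ E → ww i j ∈ P) :
    ∃ k ∈ E, uu k ∉ P := by
  by_contra! H
  have h := sum_nonneg_of_notMem_kappa hn hf hP (fun i => if i ∈ E then 1 else -1)
    (fun i j hij => ?_) fun k hk => ?_
  · rw [Finset.sum_ite, Finset.sum_const, Finset.sum_const, Finset.filter_mem_eq_inter,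
      Finset.univ_inter, Finset.filter_notMem_eq_sdiff, ← Finset.compl_eq_univ_sdiff,
      Finset.card_compl] at h
    simp at h
    omega
  · by_cases h1 : i ∈ E
    · by_cases h2 : j ∈ E <;> simp [h1, h2]
    · by_cases h2 : j ∈ E
      · simp [h1, h2]
      · exact absurd (hw i j h1 h2) hij
  · have hkE : k ∉ E := fun h => hk (H k h)
    simp [hkE]

theorem prod_notMem [P.IsPrime] {L : List (RR × Lam)} (hL : ∀ x ∈ L, x.1 ∉ P) :
    (L.map Prod.fst).prod ∉ P := by
  induction L with
  | nil => exact (Ideal.ne_top_iff_one P).mp (Ideal.IsPrime.ne_top ‹_›)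
  | cons x L ih =>
    simp only [List.map_cons, List.prod_cons]
    exact (Ideal.IsPrime.mul_notMem ‹_› (hL x (by simp)) (ih fun y hy => hL y (by simp [hy])))

/-- A semistable point lies in `D(g)` for some good `g` of degree `κ`. Call two indices equivalent if
`φ_{ij} t_i t_j` vanishes at the point; by the Plücker relations this is an equivalence relation. If
no class has three elements there is a `5`-cycle of nonvanishing `φ_{ij} t_i t_j`; otherwise some
`t_k⁻²` with `k` outside of the large class does not vanish, and compensates for the imbalance. -/
theorem exists_isGood [P.IsPrime] (hn : 0 < n) (hf : f ∈ piece (n • kappa)) (hP : f ∉ P) :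
    ∃ g, IsGood 1 g ∧ g ∉ P := by
  have htr : ∀ {i j k}, ww i j ∈ P → ww j k ∈ P → ww i k ∈ P :=
    fun h1 h2 => ww_trans hn hf hP h1 h2
  have hsw : ∀ {i j}, ww i j ∈ P → ww j i ∈ P := fun h => ww_swap_mem_iff.mpr h
  have hself : ∀ i, ww i i ∈ P := fun i => ww_self i ▸ P.zero_mem
  have four : ∀ {a b c d e : Fin 5}, [a, b, c, d, e].Nodup → ww a b ∈ P → ww b c ∈ P →
      ww d a ∈ P → ∃ g, IsGood 1 g ∧ g ∉ P := by
    intro a b c d e h hab hbc hda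
    have hall : ∀ i, i ≠ e → ww i a ∈ P := fun i =>
      forall_of_nodup (p := fun i => i ≠ e → ww i a ∈ P) h (fun _ => hself a)
      (fun _ => hsw hab) (fun _ => hsw (htr hab hbc)) (fun _ => hda) (fun h => absurd rfl h) i
    have hadj : ∀ i, i ≠ e → ww e i ∉ P := by
      intro i hi he
      obtain ⟨j, hj⟩ := exists_ww_notMem hn hf hP i
      by_cases hje : j = e
      · subst hje; exact hj (hsw he)
      · exact hj (htr (hall i hi) (hsw (hall j hje)))
    obtain ⟨k, hk, hu⟩ := exists_uu_notMem hn hf hP {e} (by simp) fun i j hi hj =>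
      htr (hall i (by simpa using hi)) (hsw (hall j (by simpa using hj)))
    obtain rfl : k = e := by simpa using hk
    refine ⟨_, isGood_four_one h, prod_notMem ?_⟩
    obtain ⟨-, -, -, hae, -, -, hbe, -, hce, hde⟩ := pairwise_of_nodup h
    simp [wP, uP, hu, hadj a hae, hadj b hbe, hadj c hce, hadj d hde]
  have three : ∀ {a b c d e : Fin 5}, [a, b, c, d, e].Nodup → ww a b ∈ P → ww b c ∈ P →
      ww d a ∉ P → ww e a ∉ P → uu e ∉ P → ∃ g, IsGood 1 g ∧ g ∉ P := by
    intro a b c d e h hab hbc hda hea hu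
    have h1 : ww d b ∉ P := fun h => hda (htr h (hsw hab))
    have h2 : ww e b ∉ P := fun h => hea (htr h (hsw hab))
    have h3 : ww e c ∉ P := fun h => h2 (htr h (hsw hbc))
    refine ⟨_, isGood_three_one_one h, prod_notMem ?_⟩
    simp [wP, uP, *]
  by_cases H : ∃ a b c d e : Fin 5, [a, b, c, d, e].Nodup ∧ ww a b ∈ P ∧ ww b c ∈ P
  · obtain ⟨a, b, c, d, e, h, hab, hbc⟩ := H
    have h' : [a, b, c, e, d].Nodup :=
      (List.Perm.nodup_iff (.cons _ (.cons _ (.cons _ (.swap _ _ _))))).mp h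
    by_cases hda : ww d a ∈ P
    · exact four h hab hbc hda
    by_cases hea : ww e a ∈ P
    · exact four h' hab hbc hea
    have hall : ∀ i, i ∉ ({d, e} : Finset (Fin 5)) → ww i a ∈ P := fun i =>
      forall_of_nodup (p := fun i => i ∉ ({d, e} : Finset (Fin 5)) → ww i a ∈ P) h
        (fun _ => hself a) (fun _ => hsw hab) (fun _ => hsw (htr hab hbc)) (fun h => by simp at h) (fun h => by simp at h) i
    obtain ⟨k, hk, hu⟩ := exists_uu_notMem hn hf hP {d, e} Finset.card_le_two fun i j hi hj =>
      htr (hall i hi) (hsw (hall j hj))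
    simp only [Finset.mem_insert, Finset.mem_singleton] at hk
    rcases hk with rfl | rfl
    · exact three h' hab hbc hea hda hu
    · exact three h hab hbc hda hea hu
  · have H' : ∀ {a b c : Fin 5}, a ≠ b → a ≠ c → b ≠ c → ww a b ∈ P → ww b c ∉ P := by
      intro a b c h1 h2 h3 hab hbc
      obtain ⟨d, e, h⟩ : ∃ d e, [a, b, c, d, e].Nodup := by
        clear hab hbc; revert a b c; decide
      exact H ⟨a, b, c, d, e, h, hab, hbc⟩
    have cyc : ∀ {a b c d e : Fin 5}, [a, c, b, d, e].Nodup → ww a b ∈ P → ww d e ∉ P →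
        ∃ g, IsGood 1 g ∧ g ∉ P := by
      intro a b c d e h hab hde
      refine ⟨_, isGood_cycle h, prod_notMem ?_⟩
      obtain ⟨hac, hab', had, hae, hcb, hcd, hce, hbd, hbe, hde'⟩ := pairwise_of_nodup h
      have h1 : ww a c ∉ P := fun h' => H' hab'.symm hcb.symm hac (hsw hab) h'
      have h2 : ww c b ∉ P := fun h' => H' hab' hac hcb.symm hab (hsw h')
      have h3 : ww b d ∉ P := fun h' => H' hab' had hbd hab h'
      have h4 : ww e a ∉ P := fun h' => H' hab'.symm hbe hae (hsw hab) (hsw h')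
      simp [wP, *]
    by_cases H2 : ∃ a b, a ≠ b ∧ ww a b ∈ P
    · obtain ⟨a, b, hne, hab⟩ := H2
      obtain ⟨c, d, e, h⟩ : ∃ c d e, [a, c, b, d, e].Nodup := by
        clear hab; revert a b; decide
      by_cases hde : ww d e ∈ P
      · -- two disjoint pairs vanish, so that `c` and `d` have to change places
        have h' : [a, d, b, c, e].Nodup := by
          refine (List.Perm.nodup_iff (.cons _ ?_)).mp h
          exact ((List.Perm.swap _ _ _).trans (.cons _ (.swap _ _ _))).trans (.swap _ _ _)
        obtain ⟨hac, hab', had, hae, hcb, hcd, hce, hbd, hbe, hde'⟩ := pairwise_of_nodup h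
        exact cyc h' hab fun hec => H' hde' hcd.symm hce.symm hde (hsw hec)
      · exact cyc h hab hde
    · push Not at H2
      refine ⟨_, isGood_cycle (a := 0) (b := 1) (c := 2) (d := 3) (e := 4) (by decide),
        prod_notMem ?_⟩
      simp [wP, H2]

end Semistable

/-! ### Orbits and isotropy groups -/

theorem Pt.mem_toSpec {z : Pt} {f : RR} : f ∈ z.toSpec.asIdeal ↔ z.eval f = 0 := Iff.rfl

theorem Pt.eval_mul (z : Pt) (f g : RR) : z.eval (f * g) = z.eval f * z.eval g :=
  map_mul z.toAlgHom f g

theorem Pt.eval_pow (z : Pt) (f : RR) (k : ℕ) : z.eval (f ^ k) = z.eval f ^ k :=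
  map_pow z.toAlgHom f k

theorem Pt.eval_sub (z : Pt) (f g : RR) : z.eval (f - g) = z.eval f - z.eval g :=
  map_sub z.toAlgHom f g

theorem Pt.eval_const_smul (z : Pt) (c : ℂ) (f : RR) : z.eval (c • f) = c * z.eval f :=
  map_smul z.toAlgHom c f

theorem Pt.eval_smul_of_mem {z : Pt} {u : Lam} {f : RR} (hf : f ∈ piece u) (t : TLam) :
    (t • z).eval f = chi u t * z.eval f := by
  rw [Pt.eval_smul, act_of_mem_piece hf, Pt.eval_const_smul]

theorem chi_add (u v : Lam) (t : TLam) : chi (u + v) t = chi u t * chi v t := by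
  simp [chi]

theorem chi_nsmul (n : ℕ) (u : Lam) (t : TLam) : chi (n • u) t = chi u t ^ n := by
  simp [chi]

theorem Pt.ext_generators {z w : Pt} (h1 : ∀ i j, z.eval (ww i j) = w.eval (ww i j))
    (h2 : ∀ k, z.eval (uu k) = w.eval (uu k)) : z = w := by
  refine AlgHom.ext_of_adjoin_eq_top (φ₁ := z.toAlgHom) (φ₂ := w.toAlgHom) adjoin_generators ?_
  rintro _ (⟨⟨i, j⟩, rfl⟩ | ⟨k, rfl⟩)
  · exact h1 i j
  · exact h2 k

section Orbits

variable {n : ℕ} {g : RR}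

theorem exists_section (hg : IsGood n g) (u : Lam) : ∃ k : ℕ, ∃ s ∈ piece (k • n • kappa + u),
    ∃ s' ∈ piece (k • n • kappa - u), s * s' = g ^ (2 * k) := by
  have h : u ∈ unitDegrees (n • kappa) g := hg.2 ▸ trivial
  exact h

/-- Two points of `D(g)`, for `g` good, lie in one orbit as soon as the functions of degree `0` on
`D(g)` take the same values at both. -/
theorem exists_smul_eq (hg : IsGood n g) {z w : Pt} (hz : z.eval g ≠ 0) (hw : w.eval g ≠ 0)
    (h : ∀ k, ∀ f ∈ piece (k • n • kappa), z.eval f * w.eval g ^ k = w.eval f * z.eval g ^ k) :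
    ∃ t : TLam, t • z = w := by
  choose k s hs s' hs' e using exists_section hg
  have hz' : ∀ u, z.eval (s u) * z.eval (s' u) = z.eval g ^ (2 * k u) := fun u => by
    rw [← Pt.eval_mul, e, Pt.eval_pow]
  have hw' : ∀ u, w.eval (s u) * w.eval (s' u) = w.eval g ^ (2 * k u) := fun u => by
    rw [← Pt.eval_mul, e, Pt.eval_pow]
  have hzs : ∀ u, z.eval (s u) ≠ 0 := fun u =>
    left_ne_zero_of_mul (hz' u ▸ pow_ne_zero _ hz)
  have hws : ∀ u, w.eval (s u) ≠ 0 := fun u =>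
    left_ne_zero_of_mul (hw' u ▸ pow_ne_zero _ hw)
  let c : Lam → ℂ := fun u =>
    (w.eval (s u) * z.eval g ^ k u) / (z.eval (s u) * w.eval g ^ k u)
  have hc : ∀ u, c u ≠ 0 := fun u => div_ne_zero
    (mul_ne_zero (hws u) (pow_ne_zero _ hz)) (mul_ne_zero (hzs u) (pow_ne_zero _ hw))
  -- `c u` is the ratio of the values of all homogeneous functions of degree `u` on `D(g)`
  have key : ∀ u l, ∀ f ∈ piece (l • n • kappa + u),
      w.eval f * z.eval g ^ l = c u * (z.eval f * w.eval g ^ l) := by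
    intro u l f hf
    have h1 := h (l + k u) (f * s' u) (by
      convert mul_mem_piece hf (hs' u) using 1
      rw [add_nsmul]; abel_nf)
    simp only [Pt.eval_mul, pow_add] at h1
    have h2 := hz' u
    have h3 := hw' u
    have hz0 := hzs u
    simp only [c]
    rw [div_mul_eq_mul_div, eq_div_iff (mul_ne_zero hz0 (pow_ne_zero _ hw))]
    refine mul_right_cancel₀ (mul_ne_zero (pow_ne_zero (k u) hz) (pow_ne_zero (k u) hw)) ?_
    have e2 : ∀ x : ℂ, x ^ (2 * k u) = x ^ k u * x ^ k u := fun x => by rw [two_mul, pow_add]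
    rw [e2] at h2 h3
    linear_combination (-(z.eval (s u)) * w.eval (s u)) * h1 -
      (w.eval f * z.eval g ^ l * z.eval g ^ k u * z.eval (s u)) * h3 +
      (w.eval g ^ l * w.eval g ^ k u * w.eval (s u) * z.eval f) * h2
  have hmul : ∀ u v, c (u + v) = c u * c v := by
    intro u v
    have h1 := key (u + v) (k u + k v) (s u * s v) (by
      convert mul_mem_piece (hs u) (hs v) using 1
      rw [add_nsmul]; abel_nf)
    simp only [Pt.eval_mul, pow_add] at h1
    have hz1 := hzs u
    have hz2 := hzs v
    simp only [c] at h1 ⊢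
    rw [div_mul_div_comm, eq_div_iff (by simp [*])]
    linear_combination -h1
  let t : TLam := MonoidHom.mk' (fun u => Units.mk0 (c u.toAdd) (hc _)) fun u v =>
    Units.ext (hmul _ _)
  have ht : ∀ u, ∀ f ∈ piece u, (t • z).eval f = w.eval f := by
    intro u f hf
    have h1 := key u 0 f (by simpa using hf)
    have hct : chi u t = c u := rfl
    rw [Pt.eval_smul_of_mem hf, hct]
    simpa using h1.symm
  exact ⟨t, Pt.ext_generators (fun i j => ht _ _ (ww_mem_piece i j))
    fun k => ht _ _ (uu_mem_piece k)⟩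

/-- The character of an isotropy element is `1` on the degrees of the homogeneous functions which do not
vanish at the point, and for points of `D(g)`, `g` good, these generate `Λ`. -/
theorem stabilizer_eq_bot_of_isGood (hg : IsGood n g) {z : Pt} (hz : z.eval g ≠ 0) :
    MulAction.stabilizer TLam z = ⊥ := by
  rw [eq_bot_iff]
  intro t ht
  rw [MulAction.mem_stabilizer_iff] at ht
  have key : ∀ u, ∀ f ∈ piece u, z.eval f ≠ 0 → chi u t = 1 := by
    intro u f hf h0
    have h1 := Pt.eval_smul_of_mem (z := z) hf t
    rw [ht] at h1
    exact mul_right_cancel₀ h0 (by rw [← h1, one_mul])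
  have hκ := key _ g hg.1 hz
  refine MonoidHom.ext fun u => Units.ext ?_
  obtain ⟨k, s, hs, s', -, e⟩ := exists_section hg u.toAdd
  have h0 : z.eval s ≠ 0 := by
    refine left_ne_zero_of_mul (b := z.eval s') ?_
    rw [← Pt.eval_mul, e, Pt.eval_pow]
    exact pow_ne_zero _ hz
  have h1 := key _ s hs h0
  rw [chi_add, chi_nsmul, hκ, one_pow, one_mul] at h1
  exact h1

/-- The orbits in `D(g)`, for `g` good, are cut out by equations. -/
theorem mem_orbit_iff_of_isGood (hg : IsGood n g) {y w : Pt} (hy : y.eval g ≠ 0)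
    (hw : w.eval g ≠ 0) : w ∈ MulAction.orbit TLam y ↔ ∀ k, ∀ f ∈ piece (k • n • kappa),
      w.eval (y.eval g ^ k • f - y.eval f • g ^ k) = 0 := by
  simp only [Pt.eval_sub, Pt.eval_const_smul, Pt.eval_pow, sub_eq_zero]
  constructor
  · rintro ⟨t, rfl⟩ k f hf
    simp only [Pt.eval_smul_of_mem hf, Pt.eval_smul_of_mem hg.1, chi_nsmul]
    ring
  · intro h
    exact exists_smul_eq hg hy hw fun k f hf => by rw [← h k f hf, mul_comm]

theorem isClosed_orbit_of_isGood (hg : IsGood n g) {y : Pt} (hy : y.eval g ≠ 0) :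
    IsClosed ((↑) ⁻¹' MulAction.orbit TLam y : Set {w : Pt // w.eval g ≠ 0}) := by
  have h : ((↑) ⁻¹' MulAction.orbit TLam y : Set {w : Pt // w.eval g ≠ 0}) =
      ⋂ (k : ℕ) (f : RR) (_ : f ∈ piece (k • n • kappa)), (fun w : {w : Pt // w.eval g ≠ 0} =>
        w.1.toSpec) ⁻¹' PrimeSpectrum.zeroLocus {y.eval g ^ k • f - y.eval f • g ^ k} := by
    ext w
    simp only [Set.mem_preimage, mem_orbit_iff_of_isGood hg hy w.2, Set.mem_iInter,
      PrimeSpectrum.mem_zeroLocus, Set.singleton_subset_iff, SetLike.mem_coe, Pt.mem_toSpec]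
  rw [h]
  refine isClosed_iInter fun k => isClosed_iInter fun f => isClosed_iInter fun _ => ?_
  exact (PrimeSpectrum.isClosed_zeroLocus _).preimage
    ((continuous_induced_dom : Continuous Pt.toSpec).comp continuous_subtype_val)

end Orbits

theorem IsSemistable.exists_isGood {z : Pt} (hz : IsSemistable kappa z) :
    ∃ g, IsGood 1 g ∧ z.eval g ≠ 0 := by
  obtain ⟨n, hn, f, hf, h⟩ := hz
  exact Order32.exists_isGood (P := z.toSpec.asIdeal) hn hf h

theorem IsSemistable.stabilizer_eq_bot {z : Pt} (hz : IsSemistable kappa z) :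
    MulAction.stabilizer TLam z = ⊥ := by
  obtain ⟨g, hg, h⟩ := hz.exists_isGood
  exact stabilizer_eq_bot_of_isGood hg h

theorem IsSemistable.isStable {z : Pt} (hz : IsSemistable kappa z) : IsStable kappa z := by
  obtain ⟨g, hg, h⟩ := hz.exists_isGood
  refine ⟨?_, 1, one_pos, g, hg.1, h, fun y hy => isClosed_orbit_of_isGood hg hy⟩
  rw [hz.stabilizer_eq_bot]
  infer_instance

/-! ### Functions on `D(g)` and on its quotient -/

section GradedLemmas

variable {S : Type} [CommRing S] [Algebra ℂ S] (P : ℕ → Submodule ℂ S) [SetLike.GradedMonoid P]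

theorem eq_secMk {m : ℕ} {a : secRing P} (ha : a ∈ grade P m) :
    ∃ f, ∃ hf : f ∈ P m, a = secMk P m f hf := by
  refine ⟨(a : Polynomial S).coeff m, a.2 m, Subtype.ext (Polynomial.ext fun l => ?_)⟩
  simp only [secMk, Polynomial.coeff_monomial]
  split_ifs with h
  · rw [h]
  · exact ha l (Ne.symm h)

end GradedLemmas

section Chart

variable {n : ℕ} {g : RR}

/-- `x ∈ ℛ_g` is homogeneous of degree `u`, for `g` homogeneous of degree `n κ`. -/
def IsHomog (n : ℕ) (g : RR) (u : Lam) (x : Localization.Away g) : Prop :=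
  ∃ k : ℕ, ∃ f ∈ piece (k • n • kappa + u),
    x * algebraMap RR (Localization.Away g) g ^ k = algebraMap RR (Localization.Away g) f

theorem IsHomog.mul {u v : Lam} {x y : Localization.Away g} (hx : IsHomog n g u x)
    (hy : IsHomog n g v y) : IsHomog n g (u + v) (x * y) := by
  obtain ⟨k, f, hf, e⟩ := hx
  obtain ⟨l, f', hf', e'⟩ := hy
  refine ⟨k + l, f * f', ?_, ?_⟩
  · convert mul_mem_piece hf hf' using 1
    rw [add_nsmul]; abel_nf
  · rw [map_mul, ← e, ← e']; ring

theorem isHomog_algebraMap {u : Lam} {f : RR} (hf : f ∈ piece u) :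
    IsHomog n g u (algebraMap RR (Localization.Away g) f) :=
  ⟨0, f, by simpa using hf, by simp⟩

theorem isHomog_of_mul_pow {u : Lam} {x : Localization.Away g} {k : ℕ}
    (h : IsHomog n g (k • n • kappa + u) (x * algebraMap RR (Localization.Away g) g ^ k)) :
    IsHomog n g u x := by
  obtain ⟨l, f, hf, e⟩ := h
  refine ⟨k + l, f, ?_, ?_⟩
  · convert hf using 1
    rw [add_nsmul]; abel_nf
  · rw [← e]; ring

theorem isUnit_algebraMap_self (g : RR) : IsUnit (algebraMap RR (Localization.Away g) g) :=
  IsLocalization.Away.algebraMap_isUnit g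

theorem injective_algebraMap_away (h0 : g ≠ 0) :
    Function.Injective (algebraMap RR (Localization.Away g)) :=
  IsLocalization.injective _ (powers_le_nonZeroDivisors_of_noZeroDivisors h0)

theorem exists_mul_pow_eq (x : Localization.Away g) : ∃ k : ℕ, ∃ f : RR,
    x * algebraMap RR (Localization.Away g) g ^ k = algebraMap RR (Localization.Away g) f := by
  obtain ⟨⟨f, _, k, rfl⟩, h⟩ := IsLocalization.surj (Submonoid.powers g) x
  exact ⟨k, f, by simpa using h⟩

/-- The ring of functions on the basic open subset of the quotient given by `g`. -/
abbrev QuotAway (n : ℕ) (g : RR) (hg : g ∈ sections kappa n) : Type :=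
  HomogeneousLocalization.Away (grade (sections kappa)) (secMk (sections kappa) n g hg)

theorem isUnit_chart (hg : g ∈ sections kappa n) :
    IsUnit ((algebraMap RR (Localization.Away g)).comp (secEval (sections kappa))
      (secMk (sections kappa) n g hg)) := by
  rw [RingHom.comp_apply, secEval_secMk]
  exact isUnit_algebraMap_self g

/-- The homomorphism from the functions on the quotient of `D(g)` to the functions on `D(g)`. -/
def chartHom (hg : g ∈ sections kappa n) : QuotAway n g hg →+* Localization.Away g :=
  awayLift (grade (sections kappa)) ((algebraMap RR _).comp (secEval (sections kappa))) _
    (isUnit_chart hg)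

theorem chartHom_mk_mul (hg : g ∈ sections kappa n) (k : ℕ) (f : RR)
    (hf : f ∈ sections kappa (k • n)) :
    chartHom hg (HomogeneousLocalization.Away.mk _ (secMk_mem (sections kappa) n g hg) k
      (secMk (sections kappa) (k • n) f hf) (secMk_mem _ _ _ _)) *
        algebraMap RR (Localization.Away g) g ^ k = algebraMap RR (Localization.Away g) f := by
  have h := awayLift_mk_mul (grade (sections kappa))
    ((algebraMap RR (Localization.Away g)).comp (secEval (sections kappa))) (isUnit_chart hg)
    (secMk_mem (sections kappa) n g hg) k (secMk (sections kappa) (k • n) f hf) (secMk_mem _ _ _ _)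
  rw [RingHom.comp_apply, RingHom.comp_apply, secEval_secMk, secEval_secMk] at h
  exact h

theorem exists_chart_mk (hg : g ∈ sections kappa n) (b : QuotAway n g hg) :
    ∃ k f, ∃ hf : f ∈ sections kappa (k • n),
      b = HomogeneousLocalization.Away.mk _ (secMk_mem (sections kappa) n g hg) k
        (secMk (sections kappa) (k • n) f hf) (secMk_mem _ _ _ _) := by
  obtain ⟨k, a, ha, rfl⟩ := HomogeneousLocalization.Away.mk_surjective _
    (secMk_mem (sections kappa) n g hg) b
  obtain ⟨f, hf, rfl⟩ := eq_secMk _ ha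
  exact ⟨k, f, hf, rfl⟩

/-- The functions on the quotient of `D(g)` are the elements of degree `0` of `ℛ_g`. -/
theorem exists_chartHom_eq_iff (hg : g ∈ sections kappa n) {x : Localization.Away g} :
    (∃ b, chartHom hg b = x) ↔ IsHomog n g 0 x := by
  constructor
  · rintro ⟨b, rfl⟩
    obtain ⟨k, f, hf, rfl⟩ := exists_chart_mk hg b
    refine ⟨k, f, ?_, chartHom_mk_mul hg k f hf⟩
    rw [add_zero, smul_smul]
    exact hf
  · rintro ⟨k, f, hf, e⟩
    rw [add_zero, smul_smul] at hf
    refine ⟨_, ((isUnit_algebraMap_self g).pow k).mul_right_cancel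
      ((chartHom_mk_mul hg k f hf).trans e.symm)⟩

theorem chartHom_injective (hg : g ∈ sections kappa n) (h0 : g ≠ 0) :
    Function.Injective (chartHom hg) := by
  rw [injective_iff_map_eq_zero]
  intro b hb
  obtain ⟨k, f, hf, rfl⟩ := exists_chart_mk hg b
  have h := chartHom_mk_mul hg k f hf
  rw [hb, zero_mul] at h
  obtain rfl : f = 0 := injective_algebraMap_away h0 (h.symm.trans (map_zero _).symm)
  apply HomogeneousLocalization.val_injective
  rw [HomogeneousLocalization.Away.val_mk, HomogeneousLocalization.val_zero]
  have : secMk (sections kappa) (k • n) 0 hf = 0 := Subtype.ext (by simp [secMk])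
  rw [this, Localization.mk_zero]

theorem isUnit_algebraMap_act (hg : g ∈ sections kappa n) (t : TLam) :
    IsUnit ((algebraMap RR (Localization.Away g)).comp (act t).toRingHom g) := by
  change IsUnit (algebraMap RR (Localization.Away g) (act t g))
  rw [act_of_mem_piece hg, Algebra.smul_def, map_mul]
  exact (((chi_ne_zero _ t).isUnit.map _).map _).mul (isUnit_algebraMap_self g)

/-- The action of `t ∈ 𝕋_Λ` on `ℛ_g`. -/
def actAway (hg : g ∈ sections kappa n) (t : TLam) : Localization.Away g →+* Localization.Away g :=
  IsLocalization.Away.lift g (isUnit_algebraMap_act hg t)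

theorem actAway_algebraMap (hg : g ∈ sections kappa n) (t : TLam) (f : RR) :
    actAway hg t (algebraMap RR _ f) = algebraMap RR _ (act t f) :=
  IsLocalization.Away.lift_eq g (isUnit_algebraMap_act hg t) f

/-- The invariants in `ℛ_g` are its elements of degree `0`. -/
theorem forall_actAway_eq_iff (hg : g ∈ sections kappa n) (h0 : g ≠ 0) {x : Localization.Away g} :
    (∀ t, actAway hg t x = x) ↔ IsHomog n g 0 x := by
  have key : ∀ t k f, x * algebraMap RR (Localization.Away g) g ^ k = algebraMap RR _ f →
      (actAway hg t x = x ↔ act t f = chi (k • n • kappa) t • f) := by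
    intro t k f e
    have e1 := congrArg (actAway hg t) e
    rw [map_mul, map_pow, actAway_algebraMap, actAway_algebraMap, ← map_pow, ← map_pow,
      act_of_mem_piece (pow_mem_piece hg k)] at e1
    have hu : IsUnit (algebraMap RR (Localization.Away g) (chi (k • n • kappa) t • g ^ k)) := by
      rw [Algebra.smul_def, map_mul, map_pow]
      exact (((chi_ne_zero _ t).isUnit.map _).map _).mul ((isUnit_algebraMap_self g).pow k)
    rw [← (injective_algebraMap_away h0).eq_iff, ← e1, ← hu.mul_left_inj]
    congr! 1
    rw [Algebra.smul_def, Algebra.smul_def, map_mul, map_mul, map_pow, ← e]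
    ring
  constructor
  · intro h
    obtain ⟨k, f, e⟩ := exists_mul_pow_eq x
    refine ⟨k, f, ?_, e⟩
    rw [add_zero]
    exact mem_piece_of_act fun t => (key t k f e).mp (h t)
  · rintro ⟨k, f, hf, e⟩ t
    rw [add_zero] at hf
    exact (key t k f e).mpr (act_of_mem_piece hf t)

/-- The group of pairs of a degree and a homogeneous unit of `ℛ_g` of this degree. -/
noncomputable def homogUnits (n : ℕ) (g : RR) : AddSubgroup (Lam × Additive (Localization.Away g)ˣ) where
  carrier := {p | IsHomog n g p.1 (p.2.toMul : (Localization.Away g)ˣ) ∧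
    IsHomog n g (-p.1) ((p.2.toMul)⁻¹ : (Localization.Away g)ˣ)}
  zero_mem' := by
    have := isHomog_algebraMap (n := n) (g := g) one_mem_piece
    rw [map_one] at this
    simpa using this
  add_mem' {p q} hp hq := by
    refine ⟨hp.1.mul hq.1, ?_⟩
    have := hp.2.mul hq.2
    simp only [Prod.fst_add, Prod.snd_add, neg_add, toMul_add, mul_inv, Units.val_mul]
    exact this
  neg_mem' {p} hp := by
    refine ⟨hp.2, ?_⟩
    simpa using hp.1

instance : Module.Free ℤ Lam :=
  inferInstanceAs (Module.Free ℤ (AddSubgroup.toIntSubmodule Lam))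

/-- For `g` good, the homogeneous units of `ℛ_g` can be chosen multiplicatively, as `Λ` is free. -/
theorem exists_splitting (hg : IsGood n g) : ∃ s : Lam →+ Additive (Localization.Away g)ˣ,
    ∀ u, IsHomog n g u ((s u).toMul : (Localization.Away g)ˣ) := by
  let p : homogUnits n g →ₗ[ℤ] Lam :=
    ((AddMonoidHom.fst _ _).comp (homogUnits n g).subtype).toIntLinearMap
  have hp : Function.Surjective p := by
    intro u
    obtain ⟨k, s, hs, s', hs', e⟩ := exists_section hg u
    let γ := (isUnit_algebraMap_self g).unit
    have hγ : (γ : Localization.Away g) = algebraMap RR _ g := rfl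
    have h1 : algebraMap RR (Localization.Away g) s * algebraMap RR _ s' =
        algebraMap RR _ g ^ (2 * k) := by rw [← map_mul, e, map_pow]
    let σ : (Localization.Away g)ˣ := 
      ⟨algebraMap RR _ s * (γ⁻¹ ^ k : (Localization.Away g)ˣ),
        algebraMap RR _ s' * (γ⁻¹ ^ k : (Localization.Away g)ˣ), by
          rw [mul_mul_mul_comm, h1, ← hγ, ← Units.val_mul, ← Units.val_pow_eq_pow_val,
            ← Units.val_mul, Units.val_eq_one, two_mul, pow_add]
          group, by
          rw [mul_mul_mul_comm, mul_comm (algebraMap RR _ s'), h1, ← hγ, ← Units.val_mul,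
            ← Units.val_pow_eq_pow_val, ← Units.val_mul, Units.val_eq_one, two_mul, pow_add]
          group⟩
    have h2 : ((γ⁻¹ ^ k : (Localization.Away g)ˣ) : Localization.Away g) * algebraMap RR _ g ^ k = 1 := by
      rw [← hγ, ← Units.val_pow_eq_pow_val, ← Units.val_mul, Units.val_eq_one]
      group
    refine ⟨⟨(u, Additive.ofMul σ), ⟨k, s, hs, ?_⟩, ⟨k, s', ?_, ?_⟩⟩, rfl⟩
    · change algebraMap RR _ s * _ * _ = _
      rw [mul_assoc, h2, mul_one]
    · rwa [← sub_eq_add_neg]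
    · change algebraMap RR _ s' * _ * _ = _
      rw [mul_assoc, h2, mul_one]
  obtain ⟨s, hs⟩ := Module.projective_lifting_property p LinearMap.id hp
  refine ⟨((AddMonoidHom.snd _ _).comp (homogUnits n g).subtype).comp s.toAddMonoidHom,
    fun u => ?_⟩
  have h1 := (s u).2.1
  have h2 : (s u).1.1 = u := LinearMap.congr_fun hs u
  rw [h2] at h1
  exact h1

end Chart

/-! ### Sections of the quotient maps of the charts -/

section Retraction

variable {n : ℕ} {g : RR}

/-- Multiplying the homogeneous elements of degree `u` by `χ(u)` is a ring homomorphism. -/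
theorem exists_twist {K : Type} [CommRing K] (i : Amb →+* K) (χ : Multiplicative Lam →* K) :
    ∃ τ : Amb →+* K, ∀ u, ∀ f ∈ piece u, τ (incl f) = i (incl f) * χ (.ofAdd u) := by
  refine ⟨AddMonoidAlgebra.liftNCRingHom (i.comp AddMonoidAlgebra.singleZeroRingHom)
    { toFun := fun u => i (AddMonoidAlgebra.single u.toAdd 1) * χ u
      map_one' := by simp [← AddMonoidAlgebra.one_def]
      map_mul' := fun u v => by
        rw [toAdd_mul, map_mul χ, mul_mul_mul_comm, ← map_mul i,
          AddMonoidAlgebra.single_mul_single, one_mul] }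
    fun _ _ => Commute.all _ _, ?_⟩
  rintro u f ⟨p, hp⟩
  rw [hp]
  change AddMonoidAlgebra.liftNC _ _ _ = _
  rw [AddMonoidAlgebra.liftNC_single]
  change i (AddMonoidAlgebra.single 0 p) * (i (AddMonoidAlgebra.single u 1) * χ (.ofAdd u)) = _
  rw [← mul_assoc, ← map_mul, AddMonoidAlgebra.single_mul_single, zero_add, mul_one]

/-- For `g` good, a homogeneous element of degree `u` of `ℛ_g`, divided by the chosen homogeneous unit
of degree `u`, has degree `0`. This defines a retraction of `ℛ_g` onto the functions on the quotient;
geometrically, it is a section of `D(g) → D(g) / 𝕋_Λ`. -/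
theorem exists_retraction (hg : IsGood n g) (h0 : g ≠ 0) :
    ∃ ρ : Localization.Away g →+* QuotAway n g hg.1, ∀ b, ρ (chartHom hg.1 b) = b := by
  obtain ⟨s, hs⟩ := exists_splitting hg
  obtain ⟨K, _, _, _⟩ : ∃ (K : Type) (_ : Field K) (_ : Algebra Amb K), IsFractionRing Amb K :=
    ⟨FractionRing Amb, inferInstance, inferInstance, inferInstance⟩
  have hK : Function.Injective ((algebraMap Amb K).comp incl.toRingHom) :=
    (IsFractionRing.injective Amb K).comp incl_injective
  have hgK : IsUnit ((algebraMap Amb K).comp incl.toRingHom g) :=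
    ((map_ne_zero_iff _ hK).mpr h0).isUnit
  obtain ⟨e, he⟩ : ∃ e : Localization.Away g →+* K,
      ∀ f, e (algebraMap RR _ f) = algebraMap Amb K (incl f) :=
    ⟨_, IsLocalization.Away.lift_eq g hgK⟩
  -- the functions on the quotient, as a subring of the field of fractions
  obtain ⟨B, hB⟩ : ∃ B : Subring K, ∀ x, x ∈ B ↔ ∃ b, e (chartHom hg.1 b) = x :=
    ⟨RingHom.range (R := QuotAway n g hg.1) (e.comp (chartHom hg.1)), fun _ => Iff.rfl⟩
  have heB : ∀ x, IsHomog n g 0 x → e x ∈ B := by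
    intro x hx
    obtain ⟨b, rfl⟩ := (exists_chartHom_eq_iff hg.1).mpr hx
    exact (hB _).mpr ⟨b, rfl⟩
  let σ : Lam → (Localization.Away g)ˣ := fun u => (s u).toMul
  have hσ : ∀ u v, σ (u + v) = σ u * σ v := fun u v => by simp [σ]
  have hσ' : ∀ u, σ u * σ (-u) = 1 := fun u => by rw [← hσ, add_neg_cancel]; simp [σ]
  obtain ⟨τ, hτ₀⟩ := exists_twist (algebraMap Amb K)
    { toFun := fun u => e (σ (-u.toAdd))
      map_one' := by simp [σ]
      map_mul' := fun u v => by rw [toAdd_mul, neg_add, hσ, Units.val_mul, map_mul] }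
  have hτ : ∀ u, ∀ f ∈ piece u, τ (incl f) = e (algebraMap RR _ f * σ (-u)) := fun u f hf => by
    rw [hτ₀ u f hf, map_mul, he]; rfl
  have hτB : ∀ u, ∀ f ∈ piece u, τ (incl f) ∈ B := by
    intro u f hf
    rw [hτ u f hf]
    apply heB
    have := (isHomog_algebraMap (n := n) (g := g) hf).mul (hs (-u))
    rwa [add_neg_cancel] at this
  have hτB' : ∀ f, τ (incl f) ∈ B := by
    intro f
    have hf : f ∈ Algebra.adjoin ℂ
      (Set.range (fun p : Fin 5 × Fin 5 => ww p.1 p.2) ∪ Set.range uu) := by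
      rw [adjoin_generators]; trivial
    induction hf using Algebra.adjoin_induction with
    | mem x hx =>
      rcases hx with ⟨⟨i, j⟩, rfl⟩ | ⟨k, rfl⟩
      · exact hτB _ _ (ww_mem_piece i j)
      · exact hτB _ _ (uu_mem_piece k)
    | algebraMap c =>
      refine hτB 0 _ ?_
      rw [Algebra.algebraMap_eq_smul_one]
      exact Submodule.smul_mem _ _ one_mem_piece
    | add x y _ _ hx hy => rw [map_add, map_add]; exact add_mem hx hy
    | mul x y _ _ hx hy => rw [map_mul, map_mul]; exact mul_mem hx hy
  -- the inverse of `τ g` lies in `B` as well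
  obtain ⟨b, hb, hbg⟩ : ∃ b ∈ B, τ (incl g) * b = 1 := by
    let γ := (isUnit_algebraMap_self g).unit
    have hγ : (γ : Localization.Away g) = algebraMap RR _ g := rfl
    refine ⟨e ((γ⁻¹ : (Localization.Away g)ˣ) * σ (n • kappa)), heB _ ?_, ?_⟩
    · refine isHomog_of_mul_pow (k := 1) ?_
      rw [mul_right_comm, pow_one, ← hγ, Units.inv_mul, one_mul, one_nsmul, add_zero]
      exact hs _
    · rw [hτ _ _ hg.1, ← map_mul, ← hγ, ← Units.val_mul, ← Units.val_mul, ← Units.val_mul,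
        mul_mul_mul_comm, mul_inv_cancel, mul_comm (σ _), hσ', mul_one, Units.val_one, map_one]
  let τB : RR →+* B := (τ.comp incl.toRingHom).codRestrict B hτB'
  have hu : IsUnit (τB g) := IsUnit.of_mul_eq_one ⟨b, hb⟩ (Subtype.ext hbg)
  obtain ⟨τ', hτ'⟩ : ∃ τ' : Localization.Away g →+* B, ∀ f, τ' (algebraMap RR _ f) = τB f :=
    ⟨_, IsLocalization.Away.lift_eq g hu⟩
  have hinj : Function.Injective (e.comp (chartHom hg.1)) := by
    have he0 : Function.Injective e := by
      rw [injective_iff_map_eq_zero]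
      intro x hx
      obtain ⟨k, f, hf⟩ := exists_mul_pow_eq x
      have h1 := congrArg e hf
      rw [map_mul, hx, zero_mul, he] at h1
      obtain rfl : f = 0 := hK (h1.symm.trans (map_zero _).symm)
      rw [map_zero] at hf
      exact (((isUnit_algebraMap_self g).pow k).mul_left_eq_zero).mp hf
    exact he0.comp (chartHom_injective hg.1 h0)
  let q : QuotAway n g hg.1 →+* B :=
    (e.comp (chartHom hg.1)).codRestrict B fun b => (hB _).mpr ⟨b, rfl⟩
  let Q : QuotAway n g hg.1 ≃+* B := RingEquiv.ofBijective q
    ⟨fun x y h => hinj (congrArg Subtype.val h), by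
      rintro ⟨x, hx⟩
      obtain ⟨b, rfl⟩ := (hB x).mp hx
      exact ⟨b, rfl⟩⟩
  refine ⟨Q.symm.toRingHom.comp τ', fun b => ?_⟩
  change Q.symm (τ' _) = b
  rw [RingEquiv.symm_apply_eq]
  apply Subtype.ext
  change (τ' (chartHom hg.1 b) : K) = e (chartHom hg.1 b)
  obtain ⟨k, f, hf, h⟩ := (exists_chartHom_eq_iff hg.1).mp ⟨b, rfl⟩
  rw [add_zero] at hf
  have h1 := congrArg (fun x : B => (x : K)) (congrArg τ' h)
  have h2 := congrArg e h
  have h3 : σ (-(k • n • kappa)) = σ (-(n • kappa)) ^ k := by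
    simp only [σ, map_neg, map_nsmul]
    rfl
  have h4 : (τ' (algebraMap RR _ f) : K) = e (algebraMap RR _ f * σ (-(k • n • kappa))) := by
    rw [hτ', ← hτ _ _ hf]; rfl
  have h5 : (τ' (algebraMap RR _ g) : K) = e (algebraMap RR _ g * σ (-(n • kappa))) := by
    rw [hτ', ← hτ _ _ hg.1]; rfl
  simp only [map_mul, map_pow, MulMemClass.coe_mul, SubmonoidClass.coe_pow, h4, h5, h3,
    Units.val_pow_eq_pow_val] at h1
  rw [map_mul, map_pow] at h2
  rw [← h2] at h1
  have h6 : IsUnit ((e (algebraMap RR _ g) * e (σ (-(n • kappa)))) ^ k) :=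
    (((isUnit_algebraMap_self g).map e).mul ((σ _).isUnit.map e)).pow k
  rw [← h6.mul_left_inj, h1]
  ring

end Retraction

/-! ### The charts of the quotient morphism -/

section ChartSchemes

variable {n : ℕ} {g : RR}

theorem range_specMap_algebraMap (g : RR) :
    Set.range (Spec.map (CommRingCat.ofHom (algebraMap RR (Localization.Away g)))) =
      (PrimeSpectrum.basicOpen g : Set (PrimeSpectrum RR)) :=
  PrimeSpectrum.localization_away_comap_range _ g

instance (g : RR) :
    IsOpenImmersion (Spec.map (CommRingCat.ofHom (algebraMap RR (Localization.Away g)))) :=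
  IsOpenImmersion.of_isLocalization g

theorem basicOpen_le_ssLocus (hn : 0 < n) (hg : g ∈ sections kappa n) :
    PrimeSpectrum.basicOpen g ≤ ssLocus kappa :=
  le_iSup (fun x : PosSection kappa => PrimeSpectrum.basicOpen x.1.2) ⟨(n, g), hn, hg⟩

/-- The inclusion of `D(g) = Spec ℛ_g` in the semistable locus. -/
def chartι (hn : 0 < n) (hg : g ∈ sections kappa n) :
    Spec (CommRingCat.of (Localization.Away g)) ⟶ (ssLocus kappa).toScheme :=
  IsOpenImmersion.lift (ssLocus kappa).ι
    (Spec.map (CommRingCat.ofHom (algebraMap RR (Localization.Away g)))) (by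
      rw [range_specMap_algebraMap, Scheme.Opens.range_ι]
      exact basicOpen_le_ssLocus hn hg)

theorem chartι_ι (hn : 0 < n) (hg : g ∈ sections kappa n) :
    chartι hn hg ≫ (ssLocus kappa).ι =
      Spec.map (CommRingCat.ofHom (algebraMap RR (Localization.Away g))) :=
  IsOpenImmersion.lift_fac _ _ _

instance (hn : 0 < n) (hg : g ∈ sections kappa n) : IsOpenImmersion (chartι hn hg) :=
  have : IsOpenImmersion (chartι hn hg ≫ (ssLocus kappa).ι) := by
    rw [chartι_ι]; infer_instance
  IsOpenImmersion.of_comp _ (ssLocus kappa).ι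

theorem opensRange_chartι (hn : 0 < n) (hg : g ∈ sections kappa n) :
    (chartι hn hg).opensRange = (ssLocus kappa).ι ⁻¹ᵁ PrimeSpectrum.basicOpen g := by
  refine TopologicalSpace.Opens.ext (Set.ext fun x => ?_)
  have h : (ssLocus kappa).ι x ∈ (PrimeSpectrum.basicOpen g : Set (PrimeSpectrum RR)) ↔
      x ∈ Set.range (chartι hn hg) := by
    rw [← range_specMap_algebraMap, ← chartι_ι hn hg]
    constructor
    · rintro ⟨y, hy⟩
      exact ⟨y, (ssLocus kappa).ι.injective hy⟩
    · rintro ⟨y, rfl⟩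
      exact ⟨y, rfl⟩
  exact h.symm

theorem chartι_appTop_toFunctions (hn : 0 < n) (hg : g ∈ sections kappa n)
    (a : secRing (sections kappa)) :
    (Scheme.ΓSpecIso (CommRingCat.of (Localization.Away g))).hom
      ((chartι hn hg).appTop (toFunctions kappa a)) =
        (algebraMap RR (Localization.Away g)).comp (secEval (sections kappa)) a := by
  have h := congrArg (fun q => (Scheme.ΓSpecIso (CommRingCat.of RR)).inv ≫ q.appTop ≫
    (Scheme.ΓSpecIso (CommRingCat.of (Localization.Away g))).hom) (chartι_ι hn hg)
  simp only [Scheme.ΓSpecIso_naturality, Iso.inv_hom_id_assoc, Scheme.Hom.comp_appTop,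
    Category.assoc] at h
  exact congrArg (fun q => q.hom (secEval (sections kappa) a)) h

/-- The inclusion in the GIT quotient of its basic open subset given by `g`. -/
def quotientι (hn : 0 < n) (hg : g ∈ sections kappa n) :
    Spec (CommRingCat.of (QuotAway n g hg)) ⟶ gitQuotient kappa :=
  Proj.awayι (grade (sections kappa)) _ (secMk_mem (sections kappa) n g hg) hn

instance (hn : 0 < n) (hg : g ∈ sections kappa n) : IsOpenImmersion (quotientι hn hg) :=
  inferInstanceAs (IsOpenImmersion (Proj.awayι (grade (sections kappa)) _ _ _))

theorem chartι_quotientMap (hn : 0 < n) (hg : g ∈ sections kappa n) :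
    chartι hn hg ≫ quotientMap kappa =
      Spec.map (CommRingCat.ofHom (chartHom hg)) ≫ quotientι hn hg :=
  comp_toProj _ _ _ _ _ (chartι_appTop_toFunctions hn hg) _ _ _

/-- The basic open subset of the GIT quotient given by `g`. -/
def quotientOpen (hg : g ∈ sections kappa n) : (gitQuotient kappa).Opens :=
  Proj.basicOpen (grade (sections kappa)) (secMk (sections kappa) n g hg)

theorem opensRange_quotientι (hn : 0 < n) (hg : g ∈ sections kappa n) :
    (quotientι hn hg).opensRange = quotientOpen hg :=
  Proj.opensRange_awayι _ _ _ _

theorem preimage_quotientOpen (hn : 0 < n) (hg : g ∈ sections kappa n) :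
    quotientMap kappa ⁻¹ᵁ quotientOpen hg =
      (ssLocus kappa).ι ⁻¹ᵁ PrimeSpectrum.basicOpen g := by
  refine (toProj_preimage_basicOpen _ _ _ hn (secMk_mem (sections kappa) n g hg)).trans ?_
  rw [basicOpen_toFunctions, secEval_secMk]

theorem chartι_actSS (hn : 0 < n) (hg : g ∈ sections kappa n) (t : TLam) :
    chartι hn hg ≫ actSS kappa t =
      Spec.map (CommRingCat.ofHom (actAway hg t)) ≫ chartι hn hg := by
  rw [← cancel_mono (ssLocus kappa).ι, Category.assoc, Category.assoc, chartι_ι, actSS,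
    Scheme.Hom.resLE_comp_ι, ← Category.assoc, chartι_ι, actSpec, ← Spec.map_comp, ← Spec.map_comp]
  congr 1
  ext f
  exact (actAway_algebraMap hg t f).symm

end ChartSchemes

/-! ### A basis of the GIT quotient -/

section SecMk

variable {S : Type} [CommRing S] [Algebra ℂ S] (P : ℕ → Submodule ℂ S) [SetLike.GradedMonoid P]

theorem secMk_mul_secMk {n m : ℕ} {f f' : S} (hf : f ∈ P n) (hf' : f' ∈ P m) :
    secMk P n f hf * secMk P m f' hf' =
      secMk P (n + m) (f * f') (SetLike.GradedMul.mul_mem hf hf') :=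
  Subtype.ext (Polynomial.monomial_mul_monomial n m f f')

theorem secMk_pow {n : ℕ} {f : S} (hf : f ∈ P n) (k : ℕ) :
    secMk P n f hf ^ k = secMk P (n * k) (f ^ k)
      (by rw [mul_comm]; exact SetLike.pow_mem_graded k hf) :=
  Subtype.ext (Polynomial.monomial_pow n f k)

theorem secMk_add {n : ℕ} {f f' : S} (hf : f ∈ P n) (hf' : f' ∈ P n) :
    secMk P n (f + f') (add_mem hf hf') = secMk P n f hf + secMk P n f' hf' :=
  Subtype.ext (map_add _ f f')

theorem secMk_zero (n : ℕ) : secMk P n 0 (zero_mem _) = 0 := Subtype.ext (map_zero _)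

end SecMk

section Basis

/-- The basic open subsets given by good sections of degree `1` cover the GIT quotient. By
`exists_isGood`, a power of a section `h` of positive degree is a linear combination of good sections
in `ℛ`, and by taking a component of this relation, also in `⨁ₙ ℛ_{nκ}`. -/
theorem exists_isGood_secMk_notMem (Q : Ideal (secRing (sections kappa))) [Q.IsPrime] {m : ℕ}
    (hm : 0 < m) {h : RR} (hh : h ∈ sections kappa m) (hQ : secMk (sections kappa) m h hh ∉ Q) :
    ∃ g, ∃ hg : IsGood 1 g, secMk (sections kappa) 1 g hg.1 ∉ Q := by
  by_contra! H
  have hrad : h ∈ (Ideal.span {g | IsGood 1 g}).radical := by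
    rw [Ideal.radical_eq_sInf, Ideal.mem_sInf]
    rintro P ⟨hP, hPp⟩
    by_contra hhP
    obtain ⟨g, hg, hgP⟩ := exists_isGood (P := P) hm hh hhP
    exact hgP (hP (Ideal.subset_span hg))
  obtain ⟨N, hN⟩ := hrad
  have key : ∀ x ∈ Ideal.span {g | IsGood 1 g}, ∀ (b : RR) (l : ℕ), ∃ f,
      ∃ hf : f ∈ sections kappa (l + 1),
      (incl f).coeff ((l + 1) • kappa) = (incl (b * x)).coeff ((l + 1) • kappa) ∧
        secMk (sections kappa) (l + 1) f hf ∈ Q := by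
    intro x hx
    induction hx using Submodule.span_induction with
    | mem g hg =>
      intro b l
      obtain ⟨b', hb', e, -⟩ := exists_mem_piece_coeff ⊤ b (l • kappa)
      refine ⟨b' * g, by
        rw [sections, add_nsmul]; exact mul_mem_piece hb' hg.1, ?_, ?_⟩
      · obtain ⟨p, hp⟩ := hg.1
        have h1 : ∀ F : Amb, (F * AddMonoidAlgebra.single (1 • kappa) p).coeff ((l + 1) • kappa) =
            F.coeff (l • kappa) * p := by
          intro F
          rw [add_nsmul]
          exact AddMonoidAlgebra.coeff_mul_single_add _ _ _ _
        rw [map_mul, map_mul, hp, h1, h1, e]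
      · rw [← secMk_mul_secMk (sections kappa) (n := l) (m := 1) hb' hg.1]
        exact Q.mul_mem_left _ (H g hg)
    | zero =>
      intro b l
      refine ⟨0, zero_mem _, by simp, ?_⟩
      rw [secMk_zero]
      exact zero_mem _
    | add x y _ _ hx hy =>
      intro b l
      obtain ⟨f, hf, e, h1⟩ := hx b l
      obtain ⟨f', hf', e', h1'⟩ := hy b l
      refine ⟨f + f', add_mem hf hf', by simp [mul_add, e, e'], ?_⟩
      rw [secMk_add _ hf hf']
      exact add_mem h1 h1'
    | smul a x _ hx =>
      intro b l
      obtain ⟨f, hf, e, h1⟩ := hx (b * a) l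
      exact ⟨f, hf, by rw [e, smul_eq_mul, mul_assoc], h1⟩
  obtain ⟨l, hl⟩ : ∃ l, m * (N + 1) = l + 1 := 
    Nat.exists_eq_succ_of_ne_zero (Nat.mul_ne_zero hm.ne' N.succ_ne_zero)
  obtain ⟨f, hf, e, h1⟩ := key _ hN h l
  have h2 : h ^ (N + 1) ∈ sections kappa (l + 1) := by
    rw [← hl, mul_comm]; exact SetLike.pow_mem_graded (N + 1) hh
  obtain rfl : f = h ^ (N + 1) := eq_of_mem_piece hf h2 (by rw [e, pow_succ'])
  refine hQ (Ideal.IsPrime.mem_of_pow_mem ‹_› (N + 1) ?_)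
  rw [secMk_pow]
  convert! h1

/-- The basic open subsets given by good sections form a basis of the topology of the GIT quotient. -/
theorem exists_quotientOpen_le (U : (gitQuotient kappa).Opens) (y : gitQuotient kappa) (hy : y ∈ U) :
    ∃ n g, ∃ _ : 0 < n, ∃ hg : IsGood n g, g ≠ 0 ∧ y ∈ quotientOpen hg.1 ∧ quotientOpen hg.1 ≤ U := by
  change Proj (grade (sections kappa)) at y
  have hp : y.asHomogeneousIdeal.toIdeal.IsPrime := y.isPrime
  obtain ⟨m, hm, h, hh, hhy⟩ : ∃ m, 0 < m ∧ ∃ h, ∃ hh : h ∈ sections kappa m,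
      secMk (sections kappa) m h hh ∉ y.asHomogeneousIdeal.toIdeal := by
    by_contra! H
    refine y.not_irrelevant_le ((HomogeneousIdeal.irrelevant_le _).mpr fun i hi a ha => ?_)
    obtain ⟨f, hf, rfl⟩ := eq_secMk _ ha
    exact H i hi f hf
  obtain ⟨g, hg, hgy⟩ := exists_isGood_secMk_notMem y.asHomogeneousIdeal.toIdeal hm hh hhy
  obtain ⟨_, ⟨r, rfl⟩, hyr, hrU⟩ :=
    (TopologicalSpace.Opens.isBasis_iff_nbhd.mp (Proj.isBasis_basicOpen (grade (sections kappa)))) hy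
  rw [Proj.basicOpen_eq_iSup_proj] at hyr hrU
  obtain ⟨i, hi⟩ := TopologicalSpace.Opens.mem_iSup.mp hyr
  replace hrU := (le_iSup _ i).trans hrU
  obtain ⟨f, hf, e⟩ := eq_secMk (sections kappa)
    (show GradedRing.proj (grade (sections kappa)) i r ∈ grade (sections kappa) i from
      SetLike.coe_mem _)
  rw [e] at hi hrU
  have hgf := hg.mul (m := i) hf
  have hopen : quotientOpen hgf.1 = Proj.basicOpen (grade (sections kappa)) (secMk _ 1 g hg.1) ⊓
      Proj.basicOpen (grade (sections kappa)) (secMk _ i f hf) := by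
    rw [← Proj.basicOpen_mul]
    exact congrArg _ (secMk_mul_secMk _ _ _).symm
  have hymem : y ∈ quotientOpen hgf.1 := by
    rw [hopen]
    exact ⟨hgy, hi⟩
  refine ⟨1 + i, g * f, by omega, hgf, ?_, hymem, ?_⟩
  · intro h0
    refine (show secMk (sections kappa) (1 + i) (g * f) hgf.1 ∉ _ from hymem) ?_
    have : secMk (sections kappa) (1 + i) (g * f) hgf.1 = 0 :=
      Subtype.ext (by simp [secMk, h0])
    rw [this]
    exact zero_mem _
  · rw [hopen]
    exact inf_le_right.trans hrU

end Basis

/-! ### Fibers over closed points -/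

section Fibers

/-- The Nullstellensatz for `ℛ`. -/
theorem exists_toSpec_eq (x : PrimeSpectrum RR) (hx : IsClosed {x}) : ∃ z : Pt, z.toSpec = x := by
  have hm : x.asIdeal.IsMaximal := (PrimeSpectrum.isClosed_singleton_iff_isMaximal x).mp hx
  let _ : Field (RR ⧸ x.asIdeal) := Ideal.Quotient.field x.asIdeal
  have : Algebra.FiniteType ℂ (RR ⧸ x.asIdeal) :=
    Algebra.FiniteType.of_surjective (Ideal.Quotient.mkₐ ℂ x.asIdeal) Ideal.Quotient.mk_surjective
  have : Module.Finite ℂ (RR ⧸ x.asIdeal) := finite_of_finite_type_of_isJacobsonRing ℂ _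
  let e : ℂ ≃ₐ[ℂ] RR ⧸ x.asIdeal := AlgEquiv.ofBijective (Algebra.ofId ℂ _)
    IsAlgClosed.algebraMap_bijective_of_isIntegral
  let z : RR →ₐ[ℂ] ℂ := e.symm.toAlgHom.comp (Ideal.Quotient.mkₐ ℂ x.asIdeal)
  refine ⟨z, PrimeSpectrum.ext (Ideal.ext fun f => ?_)⟩
  change e.symm (Ideal.Quotient.mk _ f) = 0 ↔ f ∈ x.asIdeal
  rw [EmbeddingLike.map_eq_zero_iff, Ideal.Quotient.eq_zero_iff_mem]

theorem exists_toSpec_eq_of_isClosed (x : (ssLocus kappa).toScheme) (hx : IsClosed {x}) :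
    ∃ z : Pt, z.toSpec = (ssLocus kappa).ι x := by
  have : IsJacobsonRing RR := isJacobsonRing_of_finiteType (A := ℂ)
  have : JacobsonSpace SpecRR := inferInstanceAs (JacobsonSpace (PrimeSpectrum RR))
  have h := (ssLocus kappa).ι.isOpenEmbedding.preimage_closedPoints.ge hx
  exact exists_toSpec_eq _ h

/-- Closed points with the same image in the GIT quotient lie in one orbit. The image determines which
sections of positive degree vanish at a point, hence the values of the functions of degree `0` on
some `D(g)` with `g` good. -/
theorem exists_actSS_eq (x y : (ssLocus kappa).toScheme) (hx : IsClosed {x}) (hy : IsClosed {y})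
    (h : quotientMap kappa x = quotientMap kappa y) : ∃ t, actSS kappa t x = y := by
  obtain ⟨z, hz⟩ := exists_toSpec_eq_of_isClosed x hx
  obtain ⟨w, hw⟩ := exists_toSpec_eq_of_isClosed y hy
  have hD : ∀ n, 0 < n → ∀ f ∈ sections kappa n, (z.eval f = 0 ↔ w.eval f = 0) := by
    intro n hn f hf
    rw [← Pt.mem_toSpec, ← Pt.mem_toSpec, hz, hw, ← not_iff_not]
    have h1 := preimage_quotientOpen hn hf
    have h2 : x ∈ quotientMap kappa ⁻¹ᵁ quotientOpen hf ↔
        y ∈ quotientMap kappa ⁻¹ᵁ quotientOpen hf := by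
      change quotientMap kappa x ∈ quotientOpen hf ↔ quotientMap kappa y ∈ quotientOpen hf
      rw [h]
    rw [h1] at h2
    exact h2
  obtain ⟨⟨⟨n, f⟩, hn, hf⟩, hfx⟩ := TopologicalSpace.Opens.mem_iSup.mp x.2
  obtain ⟨g, hg, hgz⟩ := IsSemistable.exists_isGood (z := z)
    ⟨n, hn, f, hf, fun h0 => hfx (by rw [← Pt.mem_toSpec, hz] at h0; exact h0)⟩
  have hgw : w.eval g ≠ 0 := fun h0 => hgz ((hD 1 one_pos g hg.1).mpr h0)
  obtain ⟨t, ht⟩ := exists_smul_eq hg hgz hgw fun k f hf => by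
    rw [one_smul] at hf
    have hg1 : g ∈ sections kappa 1 := hg.1
    -- a multiple of `z(g)^k f - z(f) g^k` of positive degree vanishes at both points
    have h1 := (hD (k + 1) k.succ_pos (z.eval g ^ k • (f * g) - z.eval f • g ^ (k + 1)) (by
      refine sub_mem (Submodule.smul_mem _ _ (SetLike.GradedMul.mul_mem (i := k) hf hg1))
        (Submodule.smul_mem _ _ ?_)
      convert SetLike.pow_mem_graded (k + 1) hg1 using 1
      simp)).mp (by
        simp only [Pt.eval_sub, Pt.eval_const_smul, Pt.eval_mul, Pt.eval_pow]
        ring)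
    simp only [Pt.eval_sub, Pt.eval_const_smul, Pt.eval_mul, Pt.eval_pow] at h1
    refine mul_right_cancel₀ hgw ?_
    linear_combination -h1
  refine ⟨t, (ssLocus kappa).ι.injective ?_⟩
  have h1 : (ssLocus kappa).ι (actSS kappa t x) = actSpec t ((ssLocus kappa).ι x) :=
    congrArg (fun q : (ssLocus kappa).toScheme ⟶ SpecRR => q x) (Scheme.Hom.resLE_comp_ι _ _)
  rw [h1, ← hz, ← hw, ← ht]
  rfl

end Fibers

/-! ### The geometric quotient -/

theorem isGeometricQuotient_quotientMap :
    IsGeometricQuotient (actSS kappa) (quotientMap kappa) := by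
  let I : Type := {p : ℕ × RR // 0 < p.1 ∧ IsGood p.1 p.2 ∧ p.2 ≠ 0}
  choose ρ hρ using fun i : I => exists_retraction i.2.2.1 i.2.2.2
  have hI : ∀ i : I, i.1.2 ∈ sections kappa i.1.1 := fun i => i.2.2.1.1
  have hj : ∀ i : I, IsOpenImmersion (chartι i.2.1 (hI i)) := fun i => inferInstance
  have hk : ∀ i : I, IsOpenImmersion (quotientι i.2.1 (hI i)) := fun i => inferInstance
  refine IsGeometricQuotient.of_charts (I := I)
    (R := fun i => CommRingCat.of (Localization.Away i.1.2))
    (B := fun i => CommRingCat.of (QuotAway i.1.1 i.1.2 (hI i)))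
    _ _ (fun i => chartι i.2.1 (hI i)) (fun i => quotientι i.2.1 (hI i))
    (fun i => CommRingCat.ofHom (chartHom (hI i))) (fun i => CommRingCat.ofHom (ρ i))
    (fun i t => CommRingCat.ofHom (actAway (hI i) t))
    (fun i => chartι_quotientMap _ _) (fun i => ?_) (fun i => ?_) (fun i t => chartι_actSS _ _ t)
    (fun i x => ?_) (fun U y hy => ?_) exists_actSS_eq
  · rw [opensRange_quotientι, opensRange_chartι, preimage_quotientOpen i.2.1]
  · exact CommRingCat.hom_ext (RingHom.ext (hρ i))
  · exact (exists_chartHom_eq_iff (hI i)).trans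
      (forall_actAway_eq_iff (hI i) i.2.2.2).symm
  · obtain ⟨n, g, hn, hg, h0, h1, h2⟩ := exists_quotientOpen_le U y hy
    refine ⟨⟨(n, g), hn, hg, h0⟩, ?_⟩
    rw [opensRange_quotientι]
    exact ⟨h1, h2⟩

end Order32

end

theorem mainTheorem9 :
    (∀ z : Order32.Pt, Order32.IsSemistable Order32.kappa z →
      Order32.IsStable Order32.kappa z) ∧
    Order32.IsGeometricQuotient (Order32.actSS Order32.kappa)
      (Order32.quotientMap Order32.kappa) ∧
    (∀ z : Order32.Pt, Order32.IsSemistable Order32.kappa z →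
      MulAction.stabilizer Order32.TLam z = ⊥) := by
  exact ⟨fun _ hz => hz.isStable, Order32.isGeometricQuotient_quotientMap,
    fun _ hz => hz.stabilizer_eq_bot⟩
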